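/- Let $M$ be a Riemann surface with complex structure $J$, let $S^3\subset\mathbb H$ be the unit quaternions, and let $f\colon M\to S^3$ be a smooth conformal minimal immersion with induced metric $g$ and area form $\mathrm{vol}$ (for the orientation of $M$). Trivialise $TS^3=S^3\times\operatorname{Im}\mathbb H$ by left translation, and put $\phi=f^{-1}df\in\Omega^1(M;\operatorname{Im}\mathbb H)$. Let $V=M\times\mathbb H$, with complex structure given by right multiplication with $i$ and the standard Hermitian metric of $\mathbb H=\mathbb C^2$, be the pull-back of the spinor bundle of $S^3$; $\operatorname{Im}\mathbb H$ acts on it by left (Clifford) multiplication, and the pulled-back spin connection is $\nabla=d+\tfrac12\phi$. Let $*\alpha=\alpha\circ J$, let $K$ be the canonical bundle, and let the Higgs field $\Phi=\tfrac14(\phi-i{*\phi})\in\Gamma(K\operatorname{End}_0V)$ be the $K$-part of $\tfrac12\phi$, so that $\tfrac12\phi=\Phi-\Phi^*$. Let $R\colon M\to\operatorname{Im}\mathbb H$ be the positive unit normal of $f$ ($R=X\times Y$ for a positive orthonormal basis $X,Y$ of the tangent plane), let $II(X,Y)=-\langle\nabla_XR,\,Y\rangle$ be the second fundamental form, and let the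 Hopf field $Q\in\Gamma(K^2)$ be its $K^2$-part. Put $S^{-1}=\ker\Phi$ and $S=(S^{-1})^\perp$. Then $V=S^{-1}\oplus S$ is a smooth orthogonal splitting into complex line bundles. The form $\Phi$ is a holomorphic section of $K\operatorname{End}_0(V)$ (that is, it is trace-free and $\bar\partial^\nabla\Phi=0$); it vanishes on $S^{-1}$, and maps $S$ into $S^{-1}$, where $\Phi(Y)s=\tfrac12\,Y\cdot s$ (Clifford multiplication), and as a section of $K\operatorname{Hom}(S,S^{-1})$ it has no zeros. Identify $S^{-1}$ with the dual of $S$ by the complex determinant $\det$ on $V=M\times\mathbb C^2$, and $S\otimes S$ with $K$ by the isomorphism $s_1\otimes s_2\mapsto\det(\Phi(\cdot)s_1,s_2)$. In this sense $S$ is a spin bundle and $\Phi$ is the section $1$ of the trivial bundle $K\operatorname{Hom}(S,S^{-1})$. Accordingly $\eta\in K$ is identified with the homomorphism $\Phi(Y)s\mapsto\eta(Y)s$ from $S^{-1}$ to $S$, so that $Q$ becomes a section of $K\operatorname{Hom}(S^{-1},S)$, with adjoint $Q^*\in\Gamma(\bar K\operatorname{Hom}(S,S^{-1}))$ defined by $(Q(X)v,w)=(v,Q^*(X)w)$.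 With these identifications: 1. Let $\nabla^{spin}$ be the spin connection on $S$, i.e. the connection that induces on $S\otimes S=K$ the Levi-Civita connection of $g$, and let $\nabla^{spin^*}$ be the dual connection on $S^{-1}$. These connections exist, and with respect to $V=S^{-1}\oplus S$ $$\nabla=\begin{pmatrix}\nabla^{spin^*}&-\frac i2Q^*\\-\frac i2Q&\nabla^{spin}\end{pmatrix}.$$ 2. $\Phi=1\in H^0(M;K\operatorname{Hom}(S,S^{-1}))$ is parallel (in particular holomorphic) with respect to the connection induced by $\nabla^{spin}$, $\nabla^{spin^*}$ and the Levi-Civita connection. 3. The adjoint $\Phi^*$ vanishes on $S$, maps $S^{-1}$ to $S$, and, as a section of $\bar K\operatorname{Hom}(S^{-1},S)=\bar K\otimes K$, equals $\tfrac14(g+i\,\mathrm{vol})$, i.e. $\Phi^*(X)\Phi(Y)s=\tfrac14\big(g(X,Y)+i\,\mathrm{vol}(X,Y)\big)s$ for $s\in S$. Equivalently, under $\bar K\otimes K\cong\Lambda^2T^*M\otimes\mathbb C$, $\alpha\otimes\beta\mapsto\alpha\wedge\beta$, it is $\tfrac i2\mathrm{vol}$. -/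

import Mathlib

open scoped Manifold ContDiff Quaternion

noncomputable section

namespace MinimalSurface

/-! ### Quaternions, the three-sphere and the spinor space -/

instance finrank_quaternion : Fact (Module.finrank ℝ ℍ[ℝ] = 3 + 1) :=
  ⟨Quaternion.finrank_eq_four⟩

/-- The round three-sphere: the unit quaternions. -/
abbrev S3 : Type := Metric.sphere (0 : ℍ[ℝ]) 1

/-- The fibre `ℂ²` of the spinor bundle `V`, with its standard Hermitian metric. -/
abbrev Spinor : Type := EuclideanSpace ℂ (Fin 2)

/-- The identification `ℍ = ℂ²`, `z₁ + j z₂ ↦ (z₁, z₂)`; it is complex linear for the complex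
structure on `ℍ` given by right multiplication with `i`. -/
def toSpinor (q : ℍ[ℝ]) : Spinor := !₂[(⟨q.re, q.imI⟩ : ℂ), (⟨q.imJ, -q.imK⟩ : ℂ)]

/-- Left multiplication by `q = a + j b` on `ℍ = ℂ²` (Clifford multiplication, when `q` is
imaginary), a complex linear endomorphism; see `cliff_toSpinor`. -/
def cliff (q : ℍ[ℝ]) : Spinor →L[ℂ] Spinor :=
  Matrix.toEuclideanCLM (𝕜 := ℂ)
    !![(⟨q.re, q.imI⟩ : ℂ), -(⟨q.imJ, q.imK⟩ : ℂ);
       (⟨q.imJ, -q.imK⟩ : ℂ), (⟨q.re, -q.imI⟩ : ℂ)]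

theorem cliff_toSpinor (q p : ℍ[ℝ]) : cliff q (toSpinor p) = toSpinor (q * p) := by
  ext i
  fin_cases i <;> simp [cliff, toSpinor, Complex.ext_iff] <;> constructor <;> ring

theorem toSpinor_mul_i (p : ℍ[ℝ]) :
    toSpinor (p * (Complex.I : ℍ[ℝ])) = Complex.I • toSpinor p := by
  ext i
  fin_cases i <;>
    simp [toSpinor, Complex.ext_iff, Quaternion.re_mul, Quaternion.imI_mul, Quaternion.imJ_mul,
      Quaternion.imK_mul]

theorem norm_toSpinor (p : ℍ[ℝ]) : ‖toSpinor p‖ = ‖p‖ := by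
  rw [← sq_eq_sq₀ (norm_nonneg _) (norm_nonneg _), EuclideanSpace.norm_sq_eq, sq ‖p‖,
    ← Quaternion.normSq_eq_norm_mul_self, Quaternion.normSq_def']
  simp only [toSpinor, Fin.sum_univ_two, ← Complex.normSq_eq_norm_sq, Complex.normSq_apply]
  simp
  ring

/-- The parallel complex volume form on `V`, trivialising `Λ²V`. -/
def detForm (v w : Spinor) : ℂ := v 0 * w 1 - v 1 * w 0

variable {M : Type*} [TopologicalSpace M] [ChartedSpace ℂ M]

/-- A Riemann surface is in particular a smooth real surface. -/
instance isManifold_real [IsManifold 𝓘(ℂ) ω M] : IsManifold 𝓘(ℝ, ℂ) ∞ M := by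
  refine isManifold_of_contDiffOn 𝓘(ℝ, ℂ) ∞ M ?_
  intro e e' he he'
  have h := (contDiffGroupoid ω 𝓘(ℂ)).compatible he he'
  rw [contDiffGroupoid, mem_groupoid_of_pregroupoid] at h
  have h1 := h.1
  simp only [contDiffPregroupoid, modelWithCornersSelf_coe, modelWithCornersSelf_coe_symm,
    Function.comp_id, Function.id_comp, Set.preimage_id, Set.range_id, Set.inter_univ] at h1 ⊢
  exact (h1.restrict_scalars ℝ).of_le le_top

/-! ### Geometry of a map from a Riemann surface to the three-sphere -/

/-- The complex structure of the tangent bundle (transition maps being holomorphic, multiplication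
by `i` in a chart does not depend on the chart). -/
def rotJ {x : M} (X : TangentSpace 𝓘(ℝ, ℂ) x) : TangentSpace 𝓘(ℝ, ℂ) x :=
  (Complex.I * (show ℂ from X) : ℂ)

/-- The pull-back `φ = f⁻¹ df` of the Maurer–Cartan form: the differential of `f` with respect to
the trivialisation of `TS³` by left translation. -/
def phi (f : M → S3) (x : M) (X : TangentSpace 𝓘(ℝ, ℂ) x) : ℍ[ℝ] :=
  (f x : ℍ[ℝ])⁻¹ * mvfderiv 𝓘(ℝ, ℂ) (fun y => (f y : ℍ[ℝ])) x X

/-- The induced metric. -/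
def inducedMetric (f : M → S3) (x : M) (X Y : TangentSpace 𝓘(ℝ, ℂ) x) : ℝ :=
  inner ℝ (phi f x X) (phi f x Y)

/-- The volume form `√(det g) du ∧ dv` of the induced metric, where the tangent plane carries the
orientation given by the complex structure (`1, i` is a positive basis). -/
def volForm (f : M → S3) (x : M) (X Y : TangentSpace 𝓘(ℝ, ℂ) x) : ℝ :=
  let e₁ : TangentSpace 𝓘(ℝ, ℂ) x := (1 : ℂ)
  let e₂ : TangentSpace 𝓘(ℝ, ℂ) x := Complex.I
  Real.sqrt (inducedMetric f x e₁ e₁ * inducedMetric f x e₂ e₂ - inducedMetric f x e₁ e₂ ^ 2) *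
    ((show ℂ from X).re * (show ℂ from Y).im - (show ℂ from X).im * (show ℂ from Y).re)

/-- `f` is a smooth conformal immersion: `df` is injective and the induced metric makes `J`
orthogonal. -/
structure IsConformalImmersion (f : M → S3) : Prop where
  smooth : ContMDiff 𝓘(ℝ, ℂ) (𝓡 3) ∞ f
  injective : ∀ x, Function.Injective (mfderiv 𝓘(ℝ, ℂ) (𝓡 3) f x)
  conformal : ∀ x (X Y : TangentSpace 𝓘(ℝ, ℂ) x), inducedMetric f x (rotJ X) (rotJ Y) = inducedMetric f x X Y

/-- The positive unit normal `R : M → Im ℍ` of `f` in the left trivialisation: the normalised cross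
product (imaginary part of the quaternionic product) of `φ(X), φ(Y)` for a positive basis `X, Y`. -/
def unitNormal (f : M → S3) (x : M) : ℍ[ℝ] :=
  let c : ℍ[ℝ] := (phi f x (1 : ℂ) * phi f x Complex.I).im
  ‖c‖⁻¹ • c

/-- The pull-back `∇ = d + ½ [φ, ·]` of the Levi-Civita connection of `S³`, on sections of
`f^* TS³ = M × Im ℍ`. -/
def nablaT (f : M → S3) (W : M → ℍ[ℝ]) (x : M) (X : TangentSpace 𝓘(ℝ, ℂ) x) : ℍ[ℝ] :=
  mvfderiv 𝓘(ℝ, ℂ) W x X +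
    (2⁻¹ : ℝ) • (phi f x X * W x - W x * phi f x X)

/-- The second fundamental form, `⟨II(X), Y⟩ = -⟨∇_X R, df(Y)⟩`. -/
def II (f : M → S3) (x : M) (X Y : TangentSpace 𝓘(ℝ, ℂ) x) : ℝ :=
  - inner ℝ (nablaT f (unitNormal f) x X) (phi f x Y)

/-- Minimality: the mean curvature (half the trace of the second fundamental form) vanishes. -/
def IsMinimal (f : M → S3) : Prop :=
  ∀ x (e₁ e₂ : TangentSpace 𝓘(ℝ, ℂ) x), inducedMetric f x e₁ e₁ = 1 → inducedMetric f x e₂ e₂ = 1 →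
    inducedMetric f x e₁ e₂ = 0 → II f x e₁ e₁ + II f x e₂ e₂ = 0

/-- The Hopf field: the `K²`-part of the second fundamental form. -/
def hopf (f : M → S3) (x : M) (X Y : TangentSpace 𝓘(ℝ, ℂ) x) : ℂ :=
  (4⁻¹ : ℂ) * (((II f x X Y - II f x (rotJ X) (rotJ Y) : ℝ) : ℂ)
    - Complex.I * ((II f x (rotJ X) Y + II f x X (rotJ Y) : ℝ) : ℂ))

/-! ### The bundle `V`, the Higgs field and the splitting -/

/-- The pull-back `∇ = d + ½ φ` of the spin connection of `S³`, on sections of `V = M × ℂ²`. -/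
def nablaV (f : M → S3) (ψ : M → Spinor) (x : M) (X : TangentSpace 𝓘(ℝ, ℂ) x) : Spinor :=
  mvfderiv 𝓘(ℝ, ℂ) ψ x X + (2⁻¹ : ℂ) • cliff (phi f x X) (ψ x)

/-- The Higgs field `Φ = ¼ (φ - i * φ)` with `*φ = φ ∘ J`: the `K`-part of `½ φ`, where `φ` acts by
Clifford multiplication. -/
def higgs (f : M → S3) (x : M) (X : TangentSpace 𝓘(ℝ, ℂ) x) : Spinor →L[ℂ] Spinor :=
  (4⁻¹ : ℂ) • (cliff (phi f x X) - Complex.I • cliff (phi f x (rotJ X)))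

/-- The adjoint `Φ^*` of the Higgs field. -/
def higgsAdj (f : M → S3) (x : M) (X : TangentSpace 𝓘(ℝ, ℂ) x) : Spinor →L[ℂ] Spinor :=
  ContinuousLinearMap.adjoint (higgs f x X)

/-- `S⁻¹ = ker Φ`. -/
def spinSinv (f : M → S3) (x : M) : Submodule ℂ Spinor :=
  ⨅ X : TangentSpace 𝓘(ℝ, ℂ) x, LinearMap.ker (higgs f x X : Spinor →ₗ[ℂ] Spinor)

/-- `S`, the orthogonal complement of `S⁻¹` in `V`. -/
def spinS (f : M → S3) (x : M) : Submodule ℂ Spinor := (spinSinv f x)ᗮ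

/-- The vector field `Y` is differentiable at `x`. -/
def DiffVF [IsManifold 𝓘(ℂ) ω M] (Y : ∀ x : M, TangentSpace 𝓘(ℝ, ℂ) x) (x : M) : Prop :=
  MDifferentiableAt 𝓘(ℝ, ℂ) (𝓘(ℝ, ℂ).prod 𝓘(ℝ, ℂ))
    (fun y => Bundle.TotalSpace.mk' ℂ y (Y y)) x

/-- The section `ψ` of `V` is differentiable at `x` (as a map of real manifolds). -/
def DiffV (ψ : M → Spinor) (x : M) : Prop := MDifferentiableAt 𝓘(ℝ, ℂ) 𝓘(ℝ, Spinor) ψ x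

/-- The real directional derivative of a complex function. -/
def dC (h : M → ℂ) (x : M) (X : TangentSpace 𝓘(ℝ, ℂ) x) : ℂ :=
  mvfderiv 𝓘(ℝ, ℂ) h x X

/-- `E` is a field of subspaces of the fibres of `V`; `ψ` is a section of it. -/
def IsSection (E : M → Submodule ℂ Spinor) (ψ : M → Spinor) : Prop := ∀ y, ψ y ∈ E y

/-- `Φ` is a holomorphic section of `K End₀(V)` over `(V, ∇'')`: it is a trace-free form of type
`(1, 0)`, differentiable, and `d^∇ Φ = 0` (which on forms of type `(1, 0)` is `∂̄^∇ Φ = 0`). -/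
structure IsHolomorphicHiggs [IsManifold 𝓘(ℂ) ω M] (f : M → S3) : Prop where
  map_add : ∀ x (X Y : TangentSpace 𝓘(ℝ, ℂ) x), higgs f x (X + Y) = higgs f x X + higgs f x Y
  map_J : ∀ x (X : TangentSpace 𝓘(ℝ, ℂ) x), higgs f x (rotJ X) = Complex.I • higgs f x X
  map_smul : ∀ x (r : ℝ) (X : TangentSpace 𝓘(ℝ, ℂ) x),
    higgs f x (r • X) = (r : ℂ) • higgs f x X
  trace_zero : ∀ x (X : TangentSpace 𝓘(ℝ, ℂ) x),
    LinearMap.trace ℂ Spinor (higgs f x X : Spinor →ₗ[ℂ] Spinor) = 0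
  diff : ∀ x (Y : ∀ y : M, TangentSpace 𝓘(ℝ, ℂ) y) (ψ : M → Spinor), DiffVF Y x → DiffV ψ x →
    DiffV (fun y => higgs f y (Y y) (ψ y)) x
  dbar_zero : ∀ x (X Y : ∀ y : M, TangentSpace 𝓘(ℝ, ℂ) y) (ψ : M → Spinor),
    DiffVF X x → DiffVF Y x → DiffV ψ x →
    (nablaV f (fun y => higgs f y (Y y) (ψ y)) x (X x) - higgs f x (Y x) (nablaV f ψ x (X x)))
      - (nablaV f (fun y => higgs f y (X y) (ψ y)) x (Y x)
          - higgs f x (X x) (nablaV f ψ x (Y x)))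
      - higgs f x (VectorField.mlieBracket 𝓘(ℝ, ℂ) X Y x) (ψ x) = 0

/-! ### Connections -/

/-- `D` is the Levi-Civita connection of the induced metric: torsion-free and metric.
(In Mathlib's convention `D Y x X` is `D_X Y`.) -/
structure IsLeviCivita [IsManifold 𝓘(ℂ) ω M] (f : M → S3)
    (D : CovariantDerivative 𝓘(ℝ, ℂ) ℂ (fun x : M => TangentSpace 𝓘(ℝ, ℂ) x)) : Prop where
  torsion_zero : D.torsion = 0
  metric_compat : ∀ x (Y Z : ∀ y : M, TangentSpace 𝓘(ℝ, ℂ) y), DiffVF Y x → DiffVF Z x →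
    ∀ X : TangentSpace 𝓘(ℝ, ℂ) x,
      mvfderiv 𝓘(ℝ, ℂ) (fun y => inducedMetric f y (Y y) (Z y)) x X
        = inducedMetric f x (D Y x X) (Z x) + inducedMetric f x (Y x) (D Z x X)

/-- An operation on sections of `V`, used as a connection on a subbundle: `cov ψ x X` stands
for `cov_X ψ` at `x`. -/
abbrev ConnOp (M : Type*) [TopologicalSpace M] [ChartedSpace ℂ M] : Type _ :=
  (M → Spinor) → ∀ x : M, TangentSpace 𝓘(ℝ, ℂ) x →L[ℝ] Spinor

/-- `cov` is a complex linear connection on the subbundle `E` of `V`. -/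
structure IsConnectionOn (E : M → Submodule ℂ Spinor) (cov : ConnOp M) : Prop where
  mem : ∀ x ψ, IsSection E ψ → DiffV ψ x → ∀ X, cov ψ x X ∈ E x
  add : ∀ x ψ χ, IsSection E ψ → IsSection E χ → DiffV ψ x → DiffV χ x →
    ∀ X, cov (fun y => ψ y + χ y) x X = cov ψ x X + cov χ x X
  leibniz : ∀ x (h : M → ℂ) ψ, IsSection E ψ → MDifferentiableAt 𝓘(ℝ, ℂ) 𝓘(ℝ, ℂ) h x →
    DiffV ψ x → ∀ X, cov (fun y => h y • ψ y) x X = dC h x X • ψ x + h x • cov ψ x X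

/-- The isomorphism `S ⊗ S → K`: the Higgs field, a nowhere vanishing section of
`K Hom(S, S⁻¹)`, together with `S⁻¹ = S^*` (through `Λ²V = ℂ`) sends `s₁ ⊗ s₂` to the form
`Y ↦ det(Φ(Y) s₁, s₂)`. -/
def sqForm (f : M → S3) (x : M) (s₁ s₂ : Spinor) (Y : TangentSpace 𝓘(ℝ, ℂ) x) : ℂ :=
  detForm (higgs f x Y s₁) s₂

/-- `ns` is the spin connection on `S` belonging to the connection `D` on `TM`: the isomorphism
`S ⊗ S → K` is parallel with respect to the connections induced by `ns` on `S ⊗ S` and by `D`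
on `K`. -/
structure IsSpinConnection [IsManifold 𝓘(ℂ) ω M] (f : M → S3)
    (D : CovariantDerivative 𝓘(ℝ, ℂ) ℂ (fun x : M => TangentSpace 𝓘(ℝ, ℂ) x))
    (ns : ConnOp M) : Prop where
  isConnection : IsConnectionOn (spinS f) ns
  parallel : ∀ x s₁ s₂ (Y : ∀ y : M, TangentSpace 𝓘(ℝ, ℂ) y),
    IsSection (spinS f) s₁ → IsSection (spinS f) s₂ → DiffV s₁ x → DiffV s₂ x → DiffVF Y x →
    ∀ X : TangentSpace 𝓘(ℝ, ℂ) x,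
      dC (fun y => sqForm f y (s₁ y) (s₂ y) (Y y)) x X
        = sqForm f x (ns s₁ x X) (s₂ x) (Y x) + sqForm f x (s₁ x) (ns s₂ x X) (Y x)
          + sqForm f x (s₁ x) (s₂ x) (D Y x X)

/-- `nt` is the connection on `S⁻¹` dual to the connection `ns` on `S`, for the duality
`S⁻¹ = S^*` given by `Λ²V = ℂ`. -/
structure IsDualConnection (f : M → S3) (ns nt : ConnOp M) : Prop where
  isConnection : IsConnectionOn (spinSinv f) nt
  dual : ∀ x t s, IsSection (spinSinv f) t → IsSection (spinS f) s → DiffV t x → DiffV s x →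
    ∀ X : TangentSpace 𝓘(ℝ, ℂ) x,
      dC (fun y => detForm (t y) (s y)) x X
        = detForm (nt t x X) (s x) + detForm (t x) (ns s x X)

/-- `q` is a section of `K Hom(S⁻¹, S)` (extended by zero to `S`) which is the Hopf field under
the identification `Hom(S⁻¹, S) = K`, where `η ∈ K` is the homomorphism
`Φ(Y) s ↦ η(Y) s`, `s ∈ S`. -/
structure IsHopfOperator (f : M → S3)
    (q : ∀ x : M, TangentSpace 𝓘(ℝ, ℂ) x → Spinor →L[ℂ] Spinor) : Prop where
  map_S : ∀ x X, ∀ s ∈ spinS f x, q x X s = 0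
  map_Sinv : ∀ x X, ∀ t ∈ spinSinv f x, q x X t ∈ spinS f x
  ident : ∀ x X Y, ∀ s ∈ spinS f x, q x X (higgs f x Y s) = hopf f x X Y • s

end MinimalSurface

end

open MinimalSurface

open scoped Manifold ContDiff Quaternion

noncomputable section

namespace MinimalSurface

/-! ### Quaternion algebra -/

/-! Everything is governed by the unit normal `R`, an imaginary unit quaternion, so `R² = -1`.
Conformality says `R φ(X) = φ(JX)` (`unitNormal_mul_phi`); conjugating, `φ(X)` anticommutes with
`R`. Hence `Φ = ¼(1 - iR)φ = ¼φ(1 + iR)`. So `S⁻¹ = ker Φ` is the `i`-eigenspace of Clifford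
multiplication by `R`, and `S` is the `-i`-eigenspace because `R` is skew-Hermitian. The projections
`½(1 ∓ iR)` are smooth because `R` is, and each `φ(X)` interchanges the two lines. The adjoint is
read off from `φ(X)φ(Y) = -g(X,Y) + vol(X,Y)R` (`phi_mul_phi`) with `R = -i` on `S`.

Off the diagonal: Clifford multiplication is parallel (`nablaV_cliff`), so differentiating `Rt = it`
or `Rs = -is` expresses the component of `∇t` in `S`, or of `∇s` in `S⁻¹`, through `∇R`. The
derivative `∇R` is tangential, and `∇_X R · φ(Y) = II(X,Y) + II(X,JY)R` (`nablaNormal_mul_phi`).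
Minimality turns this on `S` into `2Q(X,Y)`, so `∇R` acts on `S⁻¹` as `Q`; as `∇R` is
skew-Hermitian, it acts on `S` as `-Q^*`.

On the diagonal: the tangential part of `d + ½[φ,·]` is the Levi-Civita connection, its torsion
vanishing by the Maurer–Cartan equation. The projected connections make `Φ` parallel
(`connSinv_higgs`) and respect `det`, because imaginary quaternions act without trace. These
properties characterise the spin connection and its dual, so arbitrary connections satisfying the
definitions agree with the projected ones on differentiable sections. Finally `d^∇Φ` reduces to the
skew part of `∇_X R · φ(Y)`, which is zero by minimality. -/

theorem add_mul_swap_of_re_eq_zero {p q : ℍ[ℝ]} (hp : p.re = 0) (hq : q.re = 0) :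
    p * q + q * p = ((-2 * inner ℝ p q : ℝ) : ℍ[ℝ]) := by
  rw [Quaternion.inner_def]
  ext <;> simp only [Quaternion.re_add, Quaternion.imI_add, Quaternion.imJ_add, Quaternion.imK_add,
    Quaternion.re_mul, Quaternion.imI_mul, Quaternion.imJ_mul, Quaternion.imK_mul,
    Quaternion.re_star, Quaternion.imI_star, Quaternion.imJ_star, Quaternion.imK_star,
    Quaternion.re_coe, Quaternion.imI_coe, Quaternion.imJ_coe, Quaternion.imK_coe, hp, hq] <;> ring

theorem star_eq_neg_of_re_eq_zero {p : ℍ[ℝ]} (hp : p.re = 0) : star p = -p := by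
  ext <;> simp [hp]

theorem mul_swap_of_inner_eq_zero {p q : ℍ[ℝ]} (hp : p.re = 0) (hq : q.re = 0)
    (h : inner ℝ p q = 0) : p * q = -(q * p) := by
  have := add_mul_swap_of_re_eq_zero hp hq
  rw [h] at this
  exact eq_neg_of_add_eq_zero_left (by simpa using this)

theorem mul_self_of_re_eq_zero {p : ℍ[ℝ]} (hp : p.re = 0) :
    p * p = ((-(‖p‖ ^ 2) : ℝ) : ℍ[ℝ]) := by
  rw [sq, ← Quaternion.normSq_eq_norm_mul_self, Quaternion.coe_neg, ← Quaternion.self_mul_star,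
    star_eq_neg_of_re_eq_zero hp, mul_neg, neg_neg]

theorem inner_eq_zero_of_mul_swap {p q : ℍ[ℝ]} (hp : p.re = 0) (hq : q.re = 0)
    (h : p * q = -(q * p)) : inner ℝ p q = 0 := by
  have h1 := add_mul_swap_of_re_eq_zero hp hq
  rw [h, neg_add_cancel] at h1
  have h2 := congrArg (fun q : ℍ[ℝ] => q.re) h1
  simp at h2
  exact h2

/-! ### Clifford multiplication -/

/-- Lets identities between Clifford multiplications be checked in `ℍ`, where they become
associativity and distributivity. -/
theorem toSpinor_surjective : Function.Surjective toSpinor := by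
  intro v
  refine ⟨⟨(v 0).re, (v 0).im, (v 1).re, -(v 1).im⟩, ?_⟩
  ext i
  fin_cases i <;> simp [toSpinor]

theorem toSpinor_add (p q : ℍ[ℝ]) : toSpinor (p + q) = toSpinor p + toSpinor q := by
  ext i
  fin_cases i <;> simp [toSpinor, Complex.ext_iff] ; ring

theorem toSpinor_smul (r : ℝ) (p : ℍ[ℝ]) : toSpinor (r • p) = r • toSpinor p := by
  ext i
  fin_cases i <;> simp [toSpinor, Complex.ext_iff]

theorem cliff_mul (p q : ℍ[ℝ]) (v : Spinor) : cliff (p * q) v = cliff p (cliff q v) := by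
  obtain ⟨r, rfl⟩ := toSpinor_surjective v
  simp only [cliff_toSpinor, mul_assoc]

/-- Clifford multiplication as a real linear map. -/
def cliffL : ℍ[ℝ] →L[ℝ] Spinor →L[ℂ] Spinor :=
  LinearMap.toContinuousLinearMap
    { toFun := cliff
      map_add' := fun p q => by
        ext1 v
        obtain ⟨r, rfl⟩ := toSpinor_surjective v
        simp only [cliff_toSpinor, add_apply, add_mul, toSpinor_add]
      map_smul' := fun r p => by
        ext1 v
        obtain ⟨q, rfl⟩ := toSpinor_surjective v
        simp only [cliff_toSpinor, smul_apply, smul_mul_assoc, toSpinor_smul,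
          RingHom.id_apply] }

theorem cliffL_apply (p : ℍ[ℝ]) : cliffL p = cliff p := rfl

theorem cliff_add (p q : ℍ[ℝ]) : cliff (p + q) = cliff p + cliff q := map_add cliffL p q

theorem cliff_sub (p q : ℍ[ℝ]) : cliff (p - q) = cliff p - cliff q := map_sub cliffL p q

theorem cliff_neg (p : ℍ[ℝ]) : cliff (-p) = -cliff p := map_neg cliffL p

theorem cliff_smul (r : ℝ) (p : ℍ[ℝ]) : cliff (r • p) = (r : ℂ) • cliff p :=
  (map_smul cliffL r p).trans (by ext v : 1; simp [cliffL_apply])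

theorem cliff_one : cliff 1 = 1 := by
  ext1 v
  obtain ⟨r, rfl⟩ := toSpinor_surjective v
  simp [cliff_toSpinor]

theorem cliff_coe (r : ℝ) : cliff (r : ℍ[ℝ]) = (r : ℂ) • 1 := by
  rw [← cliff_one, ← cliff_smul]
  congr 1
  ext <;> simp

/-- The conjugate transpose of the matrix of `p` is the matrix of the conjugate quaternion. -/
theorem adjoint_cliff {p : ℍ[ℝ]} (hp : p.re = 0) :
    ContinuousLinearMap.adjoint (cliff p) = -cliff p := by
  rw [← cliff_neg, cliff, cliff, ← ContinuousLinearMap.star_eq_adjoint, ← map_star]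
  congr 1
  ext i j
  fin_cases i <;> fin_cases j <;> simp [Matrix.star_apply, Complex.ext_iff, hp]

theorem trace_cliff (p : ℍ[ℝ]) :
    LinearMap.trace ℂ Spinor (cliff p : Spinor →ₗ[ℂ] Spinor) = ((2 * p.re : ℝ) : ℂ) := by
  rw [LinearMap.trace_eq_matrix_trace ℂ (EuclideanSpace.basisFun (Fin 2) ℂ).toBasis]
  simp [Matrix.trace, LinearMap.toMatrix_apply, cliff, Complex.ext_iff]
  ring

/-- An endomorphism acts on `Λ²ℂ²` as a derivation by its trace. For imaginary `p` this makes
`detForm` invariant, hence parallel for `nablaV`. -/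
theorem detForm_cliff_add (p : ℍ[ℝ]) (v w : Spinor) :
    detForm (cliff p v) w + detForm v (cliff p w) = ((2 * p.re : ℝ) : ℂ) * detForm v w := by
  -- The trace is split into the two diagonal matrix entries, which are what the unfolded left side
  -- contains.
  have h : ((2 * p.re : ℝ) : ℂ) = (⟨p.re, p.imI⟩ : ℂ) + ⟨p.re, -p.imI⟩ := by
    simp [Complex.ext_iff]; ring
  rw [h]
  simp [detForm, cliff, Matrix.vecHead, Matrix.vecTail]
  ring

theorem detForm_add_left (u v w : Spinor) : detForm (u + v) w = detForm u w + detForm v w := by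
  simp [detForm]; ring

theorem detForm_add_right (u v w : Spinor) : detForm u (v + w) = detForm u v + detForm u w := by
  simp [detForm]; ring

theorem detForm_smul_left (c : ℂ) (v w : Spinor) : detForm (c • v) w = c * detForm v w := by
  simp [detForm]; ring

theorem detForm_smul_right (c : ℂ) (v w : Spinor) : detForm v (c • w) = c * detForm v w := by
  simp [detForm]; ring

theorem detForm_swap (v w : Spinor) : detForm v w = -detForm w v := by
  simp [detForm]; ring

/-- The complex volume form as a continuous real bilinear map. -/
def detFormL : Spinor →L[ℝ] Spinor →L[ℝ] ℂ :=
  LinearMap.toContinuousLinearMap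
    ((LinearMap.toContinuousLinearMap : (Spinor →ₗ[ℝ] ℂ) ≃ₗ[ℝ] (Spinor →L[ℝ] ℂ)).toLinearMap ∘ₗ
      LinearMap.mk₂ ℝ detForm detForm_add_left
        (fun c v w => by simpa using detForm_smul_left c v w) detForm_add_right
        (fun c v w => by simpa using detForm_smul_right c v w))

/-- The evaluation of Clifford multiplication as a continuous real bilinear map. -/
def cliffEvalL : ℍ[ℝ] →L[ℝ] Spinor →L[ℝ] Spinor :=
  (ContinuousLinearMap.restrictScalarsL ℂ Spinor Spinor ℝ ℝ) ∘L cliffL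

theorem cliffEvalL_apply (p : ℍ[ℝ]) (v : Spinor) : cliffEvalL p v = cliff p v := rfl

/-! ### Calculus of vector valued functions on a surface -/

section Calculus

variable {M : Type*} [TopologicalSpace M] [ChartedSpace ℂ M]
  {E F G : Type*} [NormedAddCommGroup E] [NormedSpace ℝ E] [NormedAddCommGroup F] [NormedSpace ℝ F]
  [NormedAddCommGroup G] [NormedSpace ℝ G] {x : M}

theorem two_le_infty : (2 : WithTop ℕ∞) ≤ ∞ := by
  exact ENat.LEInfty.out

theorem hasMFDerivAt_mvfderiv {u : M → E} (hu : MDifferentiableAt 𝓘(ℝ, ℂ) 𝓘(ℝ, E) u x) :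
    HasMFDerivAt 𝓘(ℝ, ℂ) 𝓘(ℝ, E) u x (mvfderiv 𝓘(ℝ, ℂ) u x) :=
  hu.hasMFDerivAt

theorem mvfderiv_eq_of_hasMFDerivAt {u : M → E} {u' : TangentSpace 𝓘(ℝ, ℂ) x →L[ℝ] E}
    (hu : HasMFDerivAt 𝓘(ℝ, ℂ) 𝓘(ℝ, E) u x u') : mvfderiv 𝓘(ℝ, ℂ) u x = u' :=
  hu.mfderiv

theorem hasMFDerivAt_bilin (B : E →L[ℝ] F →L[ℝ] G) {u : M → E} {v : M → F}
    (hu : MDifferentiableAt 𝓘(ℝ, ℂ) 𝓘(ℝ, E) u x) (hv : MDifferentiableAt 𝓘(ℝ, ℂ) 𝓘(ℝ, F) v x) :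
    HasMFDerivAt 𝓘(ℝ, ℂ) 𝓘(ℝ, G) (fun y => B (u y) (v y)) x
      ((B (u x)).comp (mvfderiv 𝓘(ℝ, ℂ) v x) + (B.flip (v x)).comp (mvfderiv 𝓘(ℝ, ℂ) u x)) := by
  have h1 := hasMFDerivAt_mvfderiv hu
  have h2 := hasMFDerivAt_mvfderiv hv
  -- This is the Fréchet product rule for the coordinate expressions; `h5` moves its coefficients
  -- back to the point `x`.
  have h3 := ContinuousLinearMap.hasFDerivWithinAt_of_bilinear B h1.2 h2.2
  have h4 : ContinuousAt (fun y => B (u y) (v y)) x :=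
    B.isBoundedBilinearMap.continuous.continuousAt.comp (h1.1.prodMk h2.1)
  refine ⟨h4, ?_⟩
  have h5 : (extChartAt 𝓘(ℝ, ℂ) x).symm (extChartAt 𝓘(ℝ, ℂ) x x) = x := extChartAt_to_inv x
  simp only [writtenInExtChartAt, extChartAt_model_space_eq_id, PartialEquiv.refl_coe,
    Function.comp_apply, h5, id] at h3
  exact h3

theorem mdifferentiableAt_bilin (B : E →L[ℝ] F →L[ℝ] G) {u : M → E} {v : M → F}
    (hu : MDifferentiableAt 𝓘(ℝ, ℂ) 𝓘(ℝ, E) u x) (hv : MDifferentiableAt 𝓘(ℝ, ℂ) 𝓘(ℝ, F) v x) :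
    MDifferentiableAt 𝓘(ℝ, ℂ) 𝓘(ℝ, G) (fun y => B (u y) (v y)) x :=
  (hasMFDerivAt_bilin B hu hv).mdifferentiableAt

theorem mvfderiv_bilin (B : E →L[ℝ] F →L[ℝ] G) {u : M → E} {v : M → F}
    (hu : MDifferentiableAt 𝓘(ℝ, ℂ) 𝓘(ℝ, E) u x) (hv : MDifferentiableAt 𝓘(ℝ, ℂ) 𝓘(ℝ, F) v x)
    (X : TangentSpace 𝓘(ℝ, ℂ) x) :
    mvfderiv 𝓘(ℝ, ℂ) (fun y => B (u y) (v y)) x X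
      = B (mvfderiv 𝓘(ℝ, ℂ) u x X) (v x) + B (u x) (mvfderiv 𝓘(ℝ, ℂ) v x X) := by
  rw [mvfderiv_eq_of_hasMFDerivAt (hasMFDerivAt_bilin B hu hv), add_comm]
  rfl

theorem hasMFDerivAt_clm (L : E →L[ℝ] F) {u : M → E}
    (hu : MDifferentiableAt 𝓘(ℝ, ℂ) 𝓘(ℝ, E) u x) :
    HasMFDerivAt 𝓘(ℝ, ℂ) 𝓘(ℝ, F) (fun y => L (u y)) x (L.comp (mvfderiv 𝓘(ℝ, ℂ) u x)) :=
  L.hasFDerivAt.hasMFDerivAt.comp x (hasMFDerivAt_mvfderiv hu)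

theorem mdifferentiableAt_clm (L : E →L[ℝ] F) {u : M → E}
    (hu : MDifferentiableAt 𝓘(ℝ, ℂ) 𝓘(ℝ, E) u x) :
    MDifferentiableAt 𝓘(ℝ, ℂ) 𝓘(ℝ, F) (fun y => L (u y)) x :=
  (hasMFDerivAt_clm L hu).mdifferentiableAt

theorem mvfderiv_clm (L : E →L[ℝ] F) {u : M → E}
    (hu : MDifferentiableAt 𝓘(ℝ, ℂ) 𝓘(ℝ, E) u x) (X : TangentSpace 𝓘(ℝ, ℂ) x) :
    mvfderiv 𝓘(ℝ, ℂ) (fun y => L (u y)) x X = L (mvfderiv 𝓘(ℝ, ℂ) u x X) := by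
  rw [mvfderiv_eq_of_hasMFDerivAt (hasMFDerivAt_clm L hu)]
  rfl

theorem mvfderiv_eq_fderiv_chart {h : M → E} (hh : MDifferentiableAt 𝓘(ℝ, ℂ) 𝓘(ℝ, E) h x)
    (X : TangentSpace 𝓘(ℝ, ℂ) x) :
    mvfderiv 𝓘(ℝ, ℂ) h x X
      = fderiv ℝ (h ∘ (extChartAt 𝓘(ℝ, ℂ) x).symm) (extChartAt 𝓘(ℝ, ℂ) x x) X := by
  rw [hh.mvfderiv]
  simp only [modelWithCornersSelf_coe, Set.range_id, fderivWithin_univ]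
  rfl

theorem eventually_mem_target (x : M) :
    ∀ᶠ z in nhds (extChartAt 𝓘(ℝ, ℂ) x x), z ∈ (extChartAt 𝓘(ℝ, ℂ) x).target :=
  extChartAt_target_mem_nhds x

/-- A function whose coordinate expression is smooth at a point is smooth there. -/
theorem contMDiffAt_of_comp_chart_symm {h : M → E} {n : WithTop ℕ∞} (hn : n ≤ ∞)
    (hh : ContDiffAt ℝ n (h ∘ (extChartAt 𝓘(ℝ, ℂ) x).symm) (extChartAt 𝓘(ℝ, ℂ) x x)) :
    ContMDiffAt 𝓘(ℝ, ℂ) 𝓘(ℝ, E) n h x := by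
  have h1 : ContMDiffAt 𝓘(ℝ, ℂ) 𝓘(ℝ, ℂ) n (extChartAt 𝓘(ℝ, ℂ) x) x :=
    (contMDiffAt_extChartAt (I := 𝓘(ℝ, ℂ)) (n := ∞)).of_le hn
  refine (hh.contMDiffAt.comp x h1).congr_of_eventuallyEq ?_
  filter_upwards [extChartAt_source_mem_nhds (I := 𝓘(ℝ, ℂ)) x] with y hy
  exact congrArg h ((extChartAt 𝓘(ℝ, ℂ) x).left_inv hy).symm

/-! ### Vector fields in a chart, the Lie bracket, and `d² = 0`. -/

variable [IsManifold 𝓘(ℂ) ω M]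

/-- The coordinate expression of a vector field in the preferred chart at `x`. -/
def chartField (Y : ∀ y : M, TangentSpace 𝓘(ℝ, ℂ) y) (x : M) (z : ℂ) : ℂ :=
  VectorField.mpullbackWithin 𝓘(ℝ, ℂ) 𝓘(ℝ, ℂ) (extChartAt 𝓘(ℝ, ℂ) x).symm Y
    (Set.range 𝓘(ℝ, ℂ)) z

instance isManifold_real_two : IsManifold 𝓘(ℝ, ℂ) 2 M :=
  IsManifold.of_le (m := 2) (n := ∞) two_le_infty

instance isManifold_real_one : IsManifold 𝓘(ℝ, ℂ) 1 M :=
  IsManifold.of_le (m := 1) (n := ∞) (by exact_mod_cast le_top)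

theorem mvfderiv_comp_chart_symm {h : M → E} {z : ℂ}
    (hz : z ∈ (extChartAt 𝓘(ℝ, ℂ) x).target)
    (hh : MDifferentiableAt 𝓘(ℝ, ℂ) 𝓘(ℝ, E) h ((extChartAt 𝓘(ℝ, ℂ) x).symm z))
    (v : ℂ) :
    fderiv ℝ (h ∘ (extChartAt 𝓘(ℝ, ℂ) x).symm) z v =
      mvfderiv 𝓘(ℝ, ℂ) h ((extChartAt 𝓘(ℝ, ℂ) x).symm z)
        (mfderivWithin 𝓘(ℝ, ℂ) 𝓘(ℝ, ℂ) (extChartAt 𝓘(ℝ, ℂ) x).symm (Set.range 𝓘(ℝ, ℂ)) z v) := by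
  have h1 := mdifferentiableWithinAt_extChartAt_symm (I := 𝓘(ℝ, ℂ)) hz
  have h2 := mfderiv_comp_mfderivWithin (I := 𝓘(ℝ, ℂ)) (I' := 𝓘(ℝ, ℂ)) (I'' := 𝓘(ℝ, E)) z hh h1
    (by simpa using uniqueMDiffWithinAt_univ 𝓘(ℝ, ℂ))
  have h3 : fderiv ℝ (h ∘ (extChartAt 𝓘(ℝ, ℂ) x).symm) z
      = mfderivWithin 𝓘(ℝ, ℂ) 𝓘(ℝ, E) (h ∘ (extChartAt 𝓘(ℝ, ℂ) x).symm) (Set.range 𝓘(ℝ, ℂ)) z := by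
    rw [modelWithCornersSelf_coe, Set.range_id, mfderivWithin_univ, mfderiv_eq_fderiv]
  rw [h3, h2]
  rfl

/-- Chain rule: the inverse of the derivative of the inverse chart, built into `chartField`, cancels
that derivative. -/
theorem mvfderiv_apply_chartField {h : M → E} {z : ℂ} (Y : ∀ y : M, TangentSpace 𝓘(ℝ, ℂ) y)
    (hz : z ∈ (extChartAt 𝓘(ℝ, ℂ) x).target)
    (hh : MDifferentiableAt 𝓘(ℝ, ℂ) 𝓘(ℝ, E) h ((extChartAt 𝓘(ℝ, ℂ) x).symm z)) :
    mvfderiv 𝓘(ℝ, ℂ) h ((extChartAt 𝓘(ℝ, ℂ) x).symm z) (Y ((extChartAt 𝓘(ℝ, ℂ) x).symm z))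
      = fderiv ℝ (h ∘ (extChartAt 𝓘(ℝ, ℂ) x).symm) z (chartField Y x z) := by
  rw [mvfderiv_comp_chart_symm hz hh]
  congr 1
  exact ((isInvertible_mfderivWithin_extChartAt_symm (I := 𝓘(ℝ, ℂ)) hz).self_apply_inverse
    _).symm

/-- Tangent vectors at `x` are coordinates in the preferred chart at `x`, whose derivative at its
own base point is therefore the identity. -/
theorem chartField_self (Y : ∀ y : M, TangentSpace 𝓘(ℝ, ℂ) y) (x : M) :
    chartField Y x (extChartAt 𝓘(ℝ, ℂ) x x) = Y x := by
  have h : (show M → ℂ from Y) ((extChartAt 𝓘(ℝ, ℂ) x).symm (extChartAt 𝓘(ℝ, ℂ) x x))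
      = (show M → ℂ from Y) x := congrArg _ (extChartAt_to_inv x)
  exact (congrArg (mfderivWithin 𝓘(ℝ, ℂ) 𝓘(ℝ, ℂ) (extChartAt 𝓘(ℝ, ℂ) x).symm
    (Set.range 𝓘(ℝ, ℂ)) (extChartAt 𝓘(ℝ, ℂ) x x)).inverse h).trans
    (mfderivWithin_extChartAt_symm_inverse_apply (I := 𝓘(ℝ, ℂ)) (Y x))

theorem DiffVF.differentiableAt_chartField {Y : ∀ y : M, TangentSpace 𝓘(ℝ, ℂ) y}
    (hY : DiffVF Y x) : DifferentiableAt ℝ (chartField Y x) (extChartAt 𝓘(ℝ, ℂ) x x) := by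
  have h := MDifferentiableWithinAt.differentiableWithinAt_mpullbackWithin_vectorField
    (I := 𝓘(ℝ, ℂ)) (s := Set.univ) (V := Y) (x := x) (mdifferentiableWithinAt_univ.2 hY)
  have h' : DifferentiableWithinAt ℝ (chartField Y x) (_ ∩ Set.range (id : ℂ → ℂ)) _ := h
  rwa [Set.preimage_univ, Set.range_id, Set.univ_inter, differentiableWithinAt_univ] at h'

theorem mlieBracket_eq_lieBracket_chartField (X Y : ∀ y : M, TangentSpace 𝓘(ℝ, ℂ) y) (x : M) :
    VectorField.mlieBracket 𝓘(ℝ, ℂ) X Y x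
      = VectorField.lieBracket ℝ (chartField X x) (chartField Y x) (extChartAt 𝓘(ℝ, ℂ) x x) := by
  rw [VectorField.mlieBracket, VectorField.mlieBracketWithin_apply, mfderiv_extChartAt_self]
  refine (congrArg (fun L : ℂ →L[ℝ] ℂ => L _) ContinuousLinearMap.inverse_id).trans ?_
  change VectorField.lieBracketWithin ℝ (chartField X x) (chartField Y x)
    (_ ∩ Set.range (id : ℂ → ℂ)) _ = _
  rw [Set.preimage_univ, Set.range_id, Set.univ_inter, VectorField.lieBracketWithin_univ]

theorem contDiffAt_comp_chart_symm {h : M → E} {n : WithTop ℕ∞} (hn : n ≤ ∞)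
    (hh : ContMDiff 𝓘(ℝ, ℂ) 𝓘(ℝ, E) n h) {z : ℂ} (hz : z ∈ (extChartAt 𝓘(ℝ, ℂ) x).target) :
    ContDiffAt ℝ n (h ∘ (extChartAt 𝓘(ℝ, ℂ) x).symm) z := by
  have h1 := (contMDiffOn_extChartAt_symm (I := 𝓘(ℝ, ℂ)) (n := ∞) x).of_le hn
  have h2 := (hh.comp_contMDiffOn h1).contMDiffAt ((isOpen_extChartAt_target x).mem_nhds hz)
  exact h2.contDiffAt

theorem mdifferentiableAt_of_comp_chart_symm {h : M → E}
    (hh : DifferentiableAt ℝ (h ∘ (extChartAt 𝓘(ℝ, ℂ) x).symm) (extChartAt 𝓘(ℝ, ℂ) x x)) :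
    MDifferentiableAt 𝓘(ℝ, ℂ) 𝓘(ℝ, E) h x := by
  have h1 : MDifferentiableAt 𝓘(ℝ, ℂ) 𝓘(ℝ, ℂ) (extChartAt 𝓘(ℝ, ℂ) x) x :=
    mdifferentiableAt_extChartAt (mem_chart_source ℂ x)
  refine (hh.mdifferentiableAt.comp x h1).congr_of_eventuallyEq ?_
  filter_upwards [extChartAt_source_mem_nhds (I := 𝓘(ℝ, ℂ)) x] with y hy
  exact congrArg h ((extChartAt 𝓘(ℝ, ℂ) x).left_inv hy).symm

theorem mvfderiv_comp_chart_eventuallyEq {h : M → E} (hh : ContMDiff 𝓘(ℝ, ℂ) 𝓘(ℝ, E) ∞ h)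
    (Y : ∀ y : M, TangentSpace 𝓘(ℝ, ℂ) y) (x : M) :
    (fun y => mvfderiv 𝓘(ℝ, ℂ) h y (Y y)) ∘ (extChartAt 𝓘(ℝ, ℂ) x).symm
      =ᶠ[nhds (extChartAt 𝓘(ℝ, ℂ) x x)]
      fun z => fderiv ℝ (h ∘ (extChartAt 𝓘(ℝ, ℂ) x).symm) z (chartField Y x z) := by
  filter_upwards [eventually_mem_target x] with z hz
  exact mvfderiv_apply_chartField Y hz (hh.mdifferentiable (by simp) _)

theorem hasFDerivAt_fderiv_chartField {h : M → E} (hh : ContMDiff 𝓘(ℝ, ℂ) 𝓘(ℝ, E) ∞ h)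
    {Y : ∀ y : M, TangentSpace 𝓘(ℝ, ℂ) y} (hY : DiffVF Y x) :
    HasFDerivAt (fun z => fderiv ℝ (h ∘ (extChartAt 𝓘(ℝ, ℂ) x).symm) z (chartField Y x z))
      ((fderiv ℝ (h ∘ (extChartAt 𝓘(ℝ, ℂ) x).symm) (extChartAt 𝓘(ℝ, ℂ) x x)).comp
          (fderiv ℝ (chartField Y x) (extChartAt 𝓘(ℝ, ℂ) x x))
        + (fderiv ℝ (fderiv ℝ (h ∘ (extChartAt 𝓘(ℝ, ℂ) x).symm)) (extChartAt 𝓘(ℝ, ℂ) x x)).flip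
          (chartField Y x (extChartAt 𝓘(ℝ, ℂ) x x))) (extChartAt 𝓘(ℝ, ℂ) x x) := by
  have h1 := contDiffAt_comp_chart_symm (le_refl _) hh (mem_extChartAt_target (I := 𝓘(ℝ, ℂ)) x)
  have h2 : DifferentiableAt ℝ (fderiv ℝ (h ∘ (extChartAt 𝓘(ℝ, ℂ) x).symm))
      (extChartAt 𝓘(ℝ, ℂ) x x) :=
    (h1.fderiv_right (m := 1) (by rw [one_add_one_eq_two]; exact two_le_infty)).differentiableAt one_ne_zero
  exact h2.hasFDerivAt.clm_apply hY.differentiableAt_chartField.hasFDerivAt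

theorem mdifferentiableAt_mvfderiv_apply {h : M → E} (hh : ContMDiff 𝓘(ℝ, ℂ) 𝓘(ℝ, E) ∞ h)
    {Y : ∀ y : M, TangentSpace 𝓘(ℝ, ℂ) y} (hY : DiffVF Y x) :
    MDifferentiableAt 𝓘(ℝ, ℂ) 𝓘(ℝ, E) (fun y => mvfderiv 𝓘(ℝ, ℂ) h y (Y y)) x := by
  apply mdifferentiableAt_of_comp_chart_symm
  exact (hasFDerivAt_fderiv_chartField hh hY).differentiableAt.congr_of_eventuallyEq
    (mvfderiv_comp_chart_eventuallyEq hh Y x)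

theorem mvfderiv_mvfderiv_apply {h : M → E} (hh : ContMDiff 𝓘(ℝ, ℂ) 𝓘(ℝ, E) ∞ h)
    {Y : ∀ y : M, TangentSpace 𝓘(ℝ, ℂ) y} (hY : DiffVF Y x) (X : TangentSpace 𝓘(ℝ, ℂ) x) :
    mvfderiv 𝓘(ℝ, ℂ) (fun y => mvfderiv 𝓘(ℝ, ℂ) h y (Y y)) x X
      = fderiv ℝ (h ∘ (extChartAt 𝓘(ℝ, ℂ) x).symm) (extChartAt 𝓘(ℝ, ℂ) x x)
          (fderiv ℝ (chartField Y x) (extChartAt 𝓘(ℝ, ℂ) x x) X)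
        + fderiv ℝ (fderiv ℝ (h ∘ (extChartAt 𝓘(ℝ, ℂ) x).symm)) (extChartAt 𝓘(ℝ, ℂ) x x) X
          (Y x) := by
  rw [mvfderiv_eq_fderiv_chart (mdifferentiableAt_mvfderiv_apply hh hY),
    (mvfderiv_comp_chart_eventuallyEq hh Y x).fderiv_eq,
    (hasFDerivAt_fderiv_chartField hh hY).fderiv, chartField_self]
  rfl

/-- The second exterior derivative of a function vanishes. -/
theorem mvfderiv_mvfderiv_sub {h : M → E} (hh : ContMDiff 𝓘(ℝ, ℂ) 𝓘(ℝ, E) ∞ h)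
    {X Y : ∀ y : M, TangentSpace 𝓘(ℝ, ℂ) y} (hX : DiffVF X x) (hY : DiffVF Y x) :
    mvfderiv 𝓘(ℝ, ℂ) (fun y => mvfderiv 𝓘(ℝ, ℂ) h y (Y y)) x (X x)
      - mvfderiv 𝓘(ℝ, ℂ) (fun y => mvfderiv 𝓘(ℝ, ℂ) h y (X y)) x (Y x)
      = mvfderiv 𝓘(ℝ, ℂ) h x (VectorField.mlieBracket 𝓘(ℝ, ℂ) X Y x) := by
  have h1 := contDiffAt_comp_chart_symm (le_refl _) hh (mem_extChartAt_target (I := 𝓘(ℝ, ℂ)) x)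
  -- Symmetry of the second derivative cancels the two Hessian terms; what is left is `dh` applied
  -- to the coordinate Lie bracket.
  have h2 := (h1.isSymmSndFDerivAt (by simpa using two_le_infty)).eq (X x) (Y x)
  rw [mvfderiv_mvfderiv_apply hh hY, mvfderiv_mvfderiv_apply hh hX,
    mvfderiv_eq_fderiv_chart (hh.mdifferentiable (by simp) x),
    mlieBracket_eq_lieBracket_chartField]
  simp only [VectorField.lieBracket, map_sub, chartField_self]
  rw [h2]
  exact add_sub_add_right_eq_sub _ _ _

/-- Seen in the preferred chart of the image point, an inverse chart is a transition map of the
Riemann surface. Its real derivative is the restriction of a complex linear map, so it commutes with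
`i`. -/
theorem mfderivWithin_chart_symm_rotJ {z : ℂ} (hz : z ∈ (extChartAt 𝓘(ℝ, ℂ) x).target) (v : ℂ) :
    mfderivWithin 𝓘(ℝ, ℂ) 𝓘(ℝ, ℂ) (extChartAt 𝓘(ℝ, ℂ) x).symm (Set.range 𝓘(ℝ, ℂ)) z
        (Complex.I * v : ℂ)
      = rotJ (mfderivWithin 𝓘(ℝ, ℂ) 𝓘(ℝ, ℂ) (extChartAt 𝓘(ℝ, ℂ) x).symm
          (Set.range 𝓘(ℝ, ℂ)) z v) := by
  have h1 := mdifferentiableWithinAt_extChartAt_symm (I := 𝓘(ℝ, ℂ)) hz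
  have h2 : DifferentiableWithinAt ℂ (writtenInExtChartAt 𝓘(ℂ) 𝓘(ℂ) z
      (extChartAt 𝓘(ℂ) x).symm) Set.univ z := by
    have h := (mdifferentiableWithinAt_extChartAt_symm (I := 𝓘(ℂ))
      (x := x) hz).differentiableWithinAt_writtenInExtChartAt
    refine (h : DifferentiableWithinAt ℂ (writtenInExtChartAt 𝓘(ℂ) 𝓘(ℂ) z
      (extChartAt 𝓘(ℂ) x).symm) _ z).mono_of_mem_nhdsWithin ?_
    simp
  have h3 := (differentiableWithinAt_univ.1 h2).hasFDerivAt.restrictScalars ℝ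
  rw [h1.mfderivWithin]
  have h4 : fderivWithin ℝ (writtenInExtChartAt 𝓘(ℝ, ℂ) 𝓘(ℝ, ℂ) z (extChartAt 𝓘(ℝ, ℂ) x).symm)
      ((extChartAt 𝓘(ℝ, ℂ) z).symm ⁻¹' Set.range 𝓘(ℝ, ℂ) ∩ Set.range 𝓘(ℝ, ℂ))
      (extChartAt 𝓘(ℝ, ℂ) z z) = (fderiv ℂ (writtenInExtChartAt 𝓘(ℂ) 𝓘(ℂ) z
        (extChartAt 𝓘(ℂ) x).symm) z).restrictScalars ℝ := by
    refine HasFDerivWithinAt.fderivWithin (HasFDerivAt.hasFDerivWithinAt h3) ?_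
    simp [uniqueDiffWithinAt_univ]
  rw [h4]
  exact ((fderiv ℂ (writtenInExtChartAt 𝓘(ℂ) 𝓘(ℂ) z (extChartAt 𝓘(ℂ) x).symm) z).map_smul
    Complex.I v)

end Calculus

/-! ### The tangent planes of a conformal immersion -/

section Pointwise

variable {M : Type*} [TopologicalSpace M] [ChartedSpace ℂ M] {f : M → S3} {x : M}

theorem inv_coe_sphere (p : S3) : (p : ℍ[ℝ])⁻¹ = star (p : ℍ[ℝ]) := by
  have h : Quaternion.normSq (p : ℍ[ℝ]) = 1 := by
    rw [Quaternion.normSq_eq_norm_mul_self, norm_eq_of_mem_sphere, one_mul]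
  rw [Quaternion.inv_def, h, inv_one, one_smul]

theorem coe_sphere_ne_zero (p : S3) : (p : ℍ[ℝ]) ≠ 0 := by
  intro h
  have := norm_eq_of_mem_sphere p
  rw [h, norm_zero] at this
  exact zero_ne_one this

/-- The Maurer–Cartan form `φ` as a continuous linear map on each tangent space. -/
def phiL (f : M → S3) (x : M) : TangentSpace 𝓘(ℝ, ℂ) x →L[ℝ] ℍ[ℝ] :=
  (ContinuousLinearMap.mul ℝ ℍ[ℝ] (f x : ℍ[ℝ])⁻¹).comp
    (mvfderiv 𝓘(ℝ, ℂ) (fun y => (f y : ℍ[ℝ])) x)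

theorem phi_add (X Y : TangentSpace 𝓘(ℝ, ℂ) x) : phi f x (X + Y) = phi f x X + phi f x Y :=
  map_add (phiL f x) X Y

theorem phi_sub (X Y : TangentSpace 𝓘(ℝ, ℂ) x) : phi f x (X - Y) = phi f x X - phi f x Y :=
  map_sub (phiL f x) X Y

theorem phi_smul (r : ℝ) (X : TangentSpace 𝓘(ℝ, ℂ) x) : phi f x (r • X) = r • phi f x X :=
  map_smul (phiL f x) r X

theorem phi_neg (X : TangentSpace 𝓘(ℝ, ℂ) x) : phi f x (-X) = -phi f x X :=
  map_neg (phiL f x) X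

theorem rotJ_add (X Y : TangentSpace 𝓘(ℝ, ℂ) x) : rotJ (X + Y) = rotJ X + rotJ Y :=
  mul_add Complex.I (show ℂ from X) (show ℂ from Y)

theorem rotJ_smul (r : ℝ) (X : TangentSpace 𝓘(ℝ, ℂ) x) : rotJ (r • X) = r • rotJ X :=
  mul_smul_comm r Complex.I (show ℂ from X)

theorem rotJ_rotJ (X : TangentSpace 𝓘(ℝ, ℂ) x) : rotJ (rotJ X) = -X := by
  change Complex.I * (Complex.I * (show ℂ from X)) = -(show ℂ from X)
  rw [← mul_assoc, Complex.I_mul_I, neg_one_mul]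

/-- The first coordinate vector of the preferred chart at `x`. -/
def coordRe (x : M) : TangentSpace 𝓘(ℝ, ℂ) x := (1 : ℂ)

/-- The second coordinate vector of the preferred chart at `x`. -/
def coordIm (x : M) : TangentSpace 𝓘(ℝ, ℂ) x := Complex.I

/-- The complex coordinate of a tangent vector in the preferred chart at `x`. -/
def coord (X : TangentSpace 𝓘(ℝ, ℂ) x) : ℂ := X

theorem coordRe_ne_zero (x : M) : coordRe x ≠ 0 := (one_ne_zero : (1 : ℂ) ≠ 0)

theorem rotJ_coordRe (x : M) : rotJ (coordRe x) = coordIm x := mul_one Complex.I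

theorem rotJ_coordIm (x : M) : rotJ (coordIm x) = -coordRe x := Complex.I_mul_I

theorem coord_rotJ_re (X : TangentSpace 𝓘(ℝ, ℂ) x) : (coord (rotJ X)).re = -(coord X).im :=
  Complex.I_mul_re _

theorem coord_rotJ_im (X : TangentSpace 𝓘(ℝ, ℂ) x) : (coord (rotJ X)).im = (coord X).re :=
  Complex.I_mul_im _

theorem eq_re_im (X : TangentSpace 𝓘(ℝ, ℂ) x) :
    X = (coord X).re • coordRe x + (coord X).im • coordIm x := by
  change (coord X) = (coord X).re • (1 : ℂ) + (coord X).im • Complex.I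
  apply Complex.ext <;> simp

theorem phi_eq_re_im (X : TangentSpace 𝓘(ℝ, ℂ) x) :
    phi f x X = (coord X).re • phi f x (coordRe x) + (coord X).im • phi f x (coordIm x) := by
  conv_lhs => rw [eq_re_im X]
  rw [phi_add, phi_smul, phi_smul]

theorem IsConformalImmersion.contMDiff_coe (hf : IsConformalImmersion f) :
    ContMDiff 𝓘(ℝ, ℂ) 𝓘(ℝ, ℍ[ℝ]) ∞ (fun y => (f y : ℍ[ℝ])) :=
  contMDiff_coe_sphere.comp hf.smooth

theorem IsConformalImmersion.mdifferentiableAt_coe (hf : IsConformalImmersion f) (x : M) :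
    MDifferentiableAt 𝓘(ℝ, ℂ) 𝓘(ℝ, ℍ[ℝ]) (fun y => (f y : ℍ[ℝ])) x :=
  hf.contMDiff_coe.mdifferentiable (by simp) x

/-- Differentiating `|f|² = 1` gives `⟨f, df⟩ = 0`, and `⟨f, df⟩` is the real part of `f̄ df`. -/
theorem phi_re (hf : IsConformalImmersion f) (X : TangentSpace 𝓘(ℝ, ℂ) x) :
    (phi f x X).re = 0 := by
  have h1 := mvfderiv_bilin (innerSL ℝ (E := ℍ[ℝ])) (hf.mdifferentiableAt_coe x)
    (hf.mdifferentiableAt_coe x) X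
  have h2 : (fun y => innerSL ℝ (E := ℍ[ℝ]) (f y : ℍ[ℝ]) (f y : ℍ[ℝ])) = fun _ => (1 : ℝ) := by
    funext y
    simp [norm_eq_of_mem_sphere]
  rw [h2, mvfderiv_const, innerSL_apply_apply, innerSL_apply_apply, real_inner_comm] at h1
  have h3 : inner ℝ (f x : ℍ[ℝ]) (mvfderiv 𝓘(ℝ, ℂ) (fun y => (f y : ℍ[ℝ])) x X) = 0 := by
    have h4 : (0 : ℝ) = _ := h1
    linarith
  rw [phi, inv_coe_sphere]
  rw [Quaternion.inner_def] at h3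
  simp at h3 ⊢
  linarith

theorem phi_injective (hf : IsConformalImmersion f) : Function.Injective (phi f x) := by
  intro X Y h
  have h1 := mul_left_cancel₀ (inv_ne_zero (coe_sphere_ne_zero (f x))) h
  apply hf.injective x
  apply injective_mvfderiv_subtypeVal_sphere (f x)
  have h2 := mfderiv_comp x (contMDiff_coe_sphere.mdifferentiable (n := ∞) (by simp) (f x))
    (hf.smooth.mdifferentiable (by simp) x)
  have h3 : ∀ Z, mvfderiv 𝓘(ℝ, ℂ) (fun y => (f y : ℍ[ℝ])) x Z
      = mvfderiv (𝓡 3) (Subtype.val : S3 → ℍ[ℝ]) (f x) (mfderiv 𝓘(ℝ, ℂ) (𝓡 3) f x Z) :=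
    fun Z => congrArg (fun L => L Z) h2
  rw [← h3, ← h3]
  exact h1

theorem phi_ne_zero (hf : IsConformalImmersion f) {X : TangentSpace 𝓘(ℝ, ℂ) x} (hX : X ≠ 0) :
    phi f x X ≠ 0 := fun h => hX (phi_injective hf (h.trans (map_zero (phiL f x)).symm))

/-- The conformal factor of the induced metric in the preferred chart at `x`. -/
def conformalFactor (f : M → S3) (x : M) : ℝ := ‖phi f x (coordRe x)‖ ^ 2

theorem conformalFactor_pos (hf : IsConformalImmersion f) (x : M) : 0 < conformalFactor f x := by
  have h := phi_ne_zero hf (coordRe_ne_zero x)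
  unfold conformalFactor
  positivity

theorem norm_phi_coordIm_sq (hf : IsConformalImmersion f) (x : M) :
    ‖phi f x (coordIm x)‖ ^ 2 = conformalFactor f x := by
  have h := hf.conformal x (coordRe x) (coordRe x)
  simp only [rotJ_coordRe, inducedMetric, real_inner_self_eq_norm_sq] at h
  exact h

/-- Invariance under `J` on the pair `(1, i)` reads `g(i, -1) = g(1, i)`. -/
theorem inner_phi_coord (hf : IsConformalImmersion f) (x : M) :
    inner ℝ (phi f x (coordRe x)) (phi f x (coordIm x)) = 0 := by
  have h := hf.conformal x (coordRe x) (coordIm x)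
  simp only [rotJ_coordRe, rotJ_coordIm, inducedMetric, phi_neg, inner_neg_right] at h
  rw [real_inner_comm] at h
  linarith

theorem phi_coordIm_mul_coordRe (hf : IsConformalImmersion f) (x : M) :
    phi f x (coordIm x) * phi f x (coordRe x) = -(phi f x (coordRe x) * phi f x (coordIm x)) :=
  mul_swap_of_inner_eq_zero (phi_re hf _) (phi_re hf _)
    ((real_inner_comm _ _).trans (inner_phi_coord hf x))

/-- The product of two orthogonal imaginary quaternions is already imaginary, and the factors here
have the same length, so both the imaginary part and the normalisation become explicit. -/
theorem unitNormal_eq (hf : IsConformalImmersion f) (x : M) :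
    unitNormal f x
      = (conformalFactor f x)⁻¹ • (phi f x (coordRe x) * phi f x (coordIm x)) := by
  have hre : (phi f x (coordRe x) * phi f x (coordIm x)).re = 0 := by
    have h := inner_phi_coord hf x
    rw [Quaternion.inner_def, star_eq_neg_of_re_eq_zero (phi_re hf _), mul_neg,
      Quaternion.re_neg] at h
    linarith
  have him : (phi f x (coordRe x) * phi f x (coordIm x)).im
      = phi f x (coordRe x) * phi f x (coordIm x) := by
    ext <;>
      simp only [Quaternion.re_im, Quaternion.imI_im, Quaternion.imJ_im, Quaternion.imK_im, hre]
  have hn : ‖phi f x (coordIm x)‖ = ‖phi f x (coordRe x)‖ := by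
    rw [← sq_eq_sq₀ (norm_nonneg _) (norm_nonneg _)]
    exact norm_phi_coordIm_sq hf x
  have h : unitNormal f x = ‖(phi f x (coordRe x) * phi f x (coordIm x)).im‖⁻¹ •
    (phi f x (coordRe x) * phi f x (coordIm x)).im := rfl
  rw [h, him, norm_mul, hn, conformalFactor, sq]

theorem phi_coordRe_mul_self (hf : IsConformalImmersion f) (x : M) :
    phi f x (coordRe x) * phi f x (coordRe x) = ((-conformalFactor f x : ℝ) : ℍ[ℝ]) :=
  mul_self_of_re_eq_zero (phi_re hf _)

theorem phi_coordIm_mul_self (hf : IsConformalImmersion f) (x : M) :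
    phi f x (coordIm x) * phi f x (coordIm x) = ((-conformalFactor f x : ℝ) : ℍ[ℝ]) := by
  rw [mul_self_of_re_eq_zero (phi_re hf _), norm_phi_coordIm_sq hf]

theorem phi_coordRe_mul_coordIm (hf : IsConformalImmersion f) (x : M) :
    phi f x (coordRe x) * phi f x (coordIm x) = conformalFactor f x • unitNormal f x := by
  rw [unitNormal_eq hf, smul_inv_smul₀ (conformalFactor_pos hf x).ne']

theorem unitNormal_mul_phi_coordRe (hf : IsConformalImmersion f) (x : M) :
    unitNormal f x * phi f x (coordRe x) = phi f x (coordIm x) := by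
  have h := (conformalFactor_pos hf x).ne'
  rw [unitNormal_eq hf, smul_mul_assoc, mul_assoc, phi_coordIm_mul_coordRe hf, mul_neg,
    ← mul_assoc, phi_coordRe_mul_self hf, Quaternion.coe_mul_eq_smul, neg_smul, neg_neg,
    inv_smul_smul₀ h]

theorem unitNormal_mul_phi_coordIm (hf : IsConformalImmersion f) (x : M) :
    unitNormal f x * phi f x (coordIm x) = -phi f x (coordRe x) := by
  have h := (conformalFactor_pos hf x).ne'
  rw [unitNormal_eq hf, smul_mul_assoc, mul_assoc, phi_coordIm_mul_self hf,
    Quaternion.mul_coe_eq_smul, neg_smul, smul_neg, inv_smul_smul₀ h]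

/-- This converts `*φ` into Clifford multiplication by `R`, and so makes `Φ` a multiple of an
eigenprojection of `R`. -/
theorem unitNormal_mul_phi (hf : IsConformalImmersion f) (X : TangentSpace 𝓘(ℝ, ℂ) x) :
    unitNormal f x * phi f x X = phi f x (rotJ X) := by
  rw [phi_eq_re_im X, phi_eq_re_im (rotJ X), mul_add, mul_smul_comm, mul_smul_comm,
    unitNormal_mul_phi_coordRe hf, unitNormal_mul_phi_coordIm hf, coord_rotJ_re, coord_rotJ_im]
  module

theorem unitNormal_mul_self (hf : IsConformalImmersion f) (x : M) :
    unitNormal f x * unitNormal f x = -1 := by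
  apply mul_right_cancel₀ (phi_ne_zero hf (coordRe_ne_zero x))
  rw [mul_assoc, unitNormal_mul_phi_coordRe hf, unitNormal_mul_phi_coordIm hf, neg_one_mul]

theorem unitNormal_re (f : M → S3) (x : M) : (unitNormal f x).re = 0 := by
  simp [unitNormal]

/-- Quaternionic conjugation of `Rφ(X) = φ(JX)`, all three factors being imaginary. -/
theorem phi_mul_unitNormal (hf : IsConformalImmersion f) (X : TangentSpace 𝓘(ℝ, ℂ) x) :
    phi f x X * unitNormal f x = -(unitNormal f x * phi f x X) := by
  have h : star (unitNormal f x * phi f x X) = star (phi f x (rotJ X)) := by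
    rw [unitNormal_mul_phi hf]
  rw [star_mul, star_eq_neg_of_re_eq_zero (phi_re hf X), star_eq_neg_of_re_eq_zero (phi_re hf _),
    star_eq_neg_of_re_eq_zero (unitNormal_re f x), neg_mul_neg, ← unitNormal_mul_phi hf] at h
  exact h

theorem inner_unitNormal_phi (hf : IsConformalImmersion f) (X : TangentSpace 𝓘(ℝ, ℂ) x) :
    inner ℝ (unitNormal f x) (phi f x X) = 0 := by
  rw [real_inner_comm]
  exact inner_eq_zero_of_mul_swap (phi_re hf X) (unitNormal_re f x) (phi_mul_unitNormal hf X)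

theorem inner_unitNormal_self (hf : IsConformalImmersion f) (x : M) :
    inner ℝ (unitNormal f x) (unitNormal f x) = 1 := by
  rw [Quaternion.inner_def, star_eq_neg_of_re_eq_zero (unitNormal_re f x), mul_neg,
    unitNormal_mul_self hf]
  simp

theorem volForm_eq (hf : IsConformalImmersion f) (X Y : TangentSpace 𝓘(ℝ, ℂ) x) :
    volForm f x X Y = conformalFactor f x *
      ((coord X).re * (coord Y).im - (coord X).im * (coord Y).re) := by
  have h : volForm f x X Y = Real.sqrt (inner ℝ (phi f x (coordRe x)) (phi f x (coordRe x))
      * inner ℝ (phi f x (coordIm x)) (phi f x (coordIm x))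
      - inner ℝ (phi f x (coordRe x)) (phi f x (coordIm x)) ^ 2) *
      ((coord X).re * (coord Y).im - (coord X).im * (coord Y).re) := rfl
  rw [h, inner_phi_coord hf, real_inner_self_eq_norm_sq, real_inner_self_eq_norm_sq,
    norm_phi_coordIm_sq hf, ← conformalFactor, sq 0, mul_zero, sub_zero,
    Real.sqrt_mul_self (conformalFactor_pos hf x).le]

theorem inducedMetric_eq (hf : IsConformalImmersion f) (X Y : TangentSpace 𝓘(ℝ, ℂ) x) :
    inducedMetric f x X Y = conformalFactor f x *
      ((coord X).re * (coord Y).re + (coord X).im * (coord Y).im) := by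
  have h : inner ℝ (phi f x (coordIm x)) (phi f x (coordRe x)) = 0 :=
    (real_inner_comm _ _).trans (inner_phi_coord hf x)
  rw [inducedMetric, phi_eq_re_im X, phi_eq_re_im Y]
  simp only [inner_add_left, inner_add_right, real_inner_smul_left, real_inner_smul_right,
    inner_phi_coord hf, h, real_inner_self_eq_norm_sq, norm_phi_coordIm_sq hf]
  rw [← conformalFactor]
  ring

/-- The scalar part of a product of imaginary quaternions is minus their inner product; the rest is
the cross product, which for tangent vectors is normal. -/
theorem phi_mul_phi (hf : IsConformalImmersion f) (X Y : TangentSpace 𝓘(ℝ, ℂ) x) :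
    phi f x X * phi f x Y
      = ((-inducedMetric f x X Y : ℝ) : ℍ[ℝ]) + volForm f x X Y • unitNormal f x := by
  rw [volForm_eq hf, inducedMetric_eq hf, phi_eq_re_im X, phi_eq_re_im Y]
  simp only [mul_add, add_mul, smul_mul_assoc, mul_smul_comm, phi_coordRe_mul_self hf,
    phi_coordIm_mul_self hf, phi_coordIm_mul_coordRe hf, phi_coordRe_mul_coordIm hf]
  generalize unitNormal f x = R
  ext <;> simp <;> ring

theorem inducedMetric_symm (X Y : TangentSpace 𝓘(ℝ, ℂ) x) :
    inducedMetric f x X Y = inducedMetric f x Y X := real_inner_comm _ _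

theorem volForm_swap (X Y : TangentSpace 𝓘(ℝ, ℂ) x) : volForm f x X Y = -volForm f x Y X := by
  simp only [volForm]
  ring

theorem volForm_eq_inducedMetric (hf : IsConformalImmersion f) (X Y : TangentSpace 𝓘(ℝ, ℂ) x) :
    volForm f x X Y = -inducedMetric f x X (rotJ Y) := by
  rw [volForm_eq hf, inducedMetric_eq hf, coord_rotJ_re, coord_rotJ_im]
  ring

/-- The left inverse of `φ` which annihilates the normal directions. -/
def phiInv (f : M → S3) (x : M) : ℍ[ℝ] →L[ℝ] TangentSpace 𝓘(ℝ, ℂ) x :=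
  (conformalFactor f x)⁻¹ • ((innerSL ℝ (phi f x (coordRe x))).smulRight (coordRe x)
    + (innerSL ℝ (phi f x (coordIm x))).smulRight (coordIm x))

theorem phiInv_apply (v : ℍ[ℝ]) : phiInv f x v = (conformalFactor f x)⁻¹ •
    (inner ℝ (phi f x (coordRe x)) v • coordRe x + inner ℝ (phi f x (coordIm x)) v • coordIm x) :=
  rfl

/-- Thus `φ ∘ phiInv` is the orthogonal projection onto the tangent plane. -/
theorem inner_phi_phiInv (hf : IsConformalImmersion f) (v : ℍ[ℝ]) (X : TangentSpace 𝓘(ℝ, ℂ) x) :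
    inner ℝ (phi f x (phiInv f x v)) (phi f x X) = inner ℝ v (phi f x X) := by
  have h := (conformalFactor_pos hf x).ne'
  have h1 : inner ℝ (phi f x (coordIm x)) (phi f x (coordRe x)) = 0 :=
    (real_inner_comm _ _).trans (inner_phi_coord hf x)
  rw [phiInv_apply, phi_smul, phi_add, phi_smul, phi_smul, phi_eq_re_im X]
  simp only [inner_add_left, inner_add_right, real_inner_smul_left, real_inner_smul_right,
    inner_phi_coord hf, h1, real_inner_self_eq_norm_sq, norm_phi_coordIm_sq hf]
  rw [← conformalFactor, real_inner_comm v, real_inner_comm v]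
  field_simp
  ring

theorem phiInv_phi (hf : IsConformalImmersion f) (X : TangentSpace 𝓘(ℝ, ℂ) x) :
    phiInv f x (phi f x X) = X := by
  apply phi_injective hf
  rw [← sub_eq_zero, ← phi_sub]
  have h : inner ℝ (phi f x (phiInv f x (phi f x X) - X))
      (phi f x (phiInv f x (phi f x X) - X)) = 0 := by
    conv_lhs => arg 2; rw [phi_sub]
    rw [inner_sub_left, inner_phi_phiInv hf, sub_self]
  exact inner_self_eq_zero.1 h

/-- The remainder `u` is imaginary and orthogonal to every `φ(X)` and to `R`, so it anticommutes
with all of them. But `R` is a multiple of `φ(1)φ(i)`, with which `u` then commutes; hence `Ru = 0`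
and `u = 0`. -/
theorem eq_phi_add_unitNormal (hf : IsConformalImmersion f) {v : ℍ[ℝ]} (hv : v.re = 0) :
    v = phi f x (phiInv f x v) + inner ℝ (unitNormal f x) v • unitNormal f x := by
  set u := v - (phi f x (phiInv f x v) + inner ℝ (unitNormal f x) v • unitNormal f x) with hu
  have hre : u.re = 0 := by simp [hu, hv, phi_re hf, unitNormal_re]
  have h1 : ∀ X, u * phi f x X = -(phi f x X * u) := fun X => by
    apply mul_swap_of_inner_eq_zero hre (phi_re hf X)
    rw [hu, inner_sub_left, inner_add_left, inner_phi_phiInv hf, real_inner_smul_left,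
      inner_unitNormal_phi hf]
    ring
  have h2 : u * unitNormal f x = -(unitNormal f x * u) := by
    apply mul_swap_of_inner_eq_zero hre (unitNormal_re f x)
    rw [hu, inner_sub_left, inner_add_left, real_inner_smul_left, inner_unitNormal_self hf,
      real_inner_comm _ (phi f x _), inner_unitNormal_phi hf, real_inner_comm v]
    ring
  have h3 : u * unitNormal f x = unitNormal f x * u := by
    rw [unitNormal_eq hf, mul_smul_comm, smul_mul_assoc, ← mul_assoc, h1, neg_mul, mul_assoc, h1,
      mul_neg, neg_neg, mul_assoc]
  have h4 : unitNormal f x * u = 0 := by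
    have h7 : (2 : ℝ) • (unitNormal f x * u) = 0 := by
      rw [two_smul]
      nth_rw 1 [← h3]
      rw [h2, neg_add_cancel]
    exact (smul_eq_zero.1 h7).resolve_left two_ne_zero
  have h5 : u = 0 := by
    have h6 := congrArg (unitNormal f x * ·) h4
    simpa [← mul_assoc, unitNormal_mul_self hf] using h6
  exact sub_eq_zero.1 h5

end Pointwise

/-! ### The pull-back of the Levi-Civita connection of the sphere -/

section LeviCivita

variable {M : Type*} [TopologicalSpace M] [ChartedSpace ℂ M] {f : M → S3} {x : M}

/-- Differentiability of a quaternion valued function on `M`. -/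
abbrev DiffQ (W : M → ℍ[ℝ]) (x : M) : Prop := MDifferentiableAt 𝓘(ℝ, ℂ) 𝓘(ℝ, ℍ[ℝ]) W x

theorem DiffQ.mul {U W : M → ℍ[ℝ]} (hU : DiffQ U x) (hW : DiffQ W x) :
    DiffQ (fun y => U y * W y) x :=
  mdifferentiableAt_bilin (ContinuousLinearMap.mul ℝ ℍ[ℝ]) hU hW

theorem mvfderiv_quaternion_mul {U W : M → ℍ[ℝ]} (hU : DiffQ U x) (hW : DiffQ W x)
    (X : TangentSpace 𝓘(ℝ, ℂ) x) :
    mvfderiv 𝓘(ℝ, ℂ) (fun y => U y * W y) x X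
      = mvfderiv 𝓘(ℝ, ℂ) U x X * W x + U x * mvfderiv 𝓘(ℝ, ℂ) W x X :=
  mvfderiv_bilin (ContinuousLinearMap.mul ℝ ℍ[ℝ]) hU hW X

/-- `nablaT` as a continuous linear map on each tangent space. -/
def nablaTL (f : M → S3) (W : M → ℍ[ℝ]) (x : M) : TangentSpace 𝓘(ℝ, ℂ) x →L[ℝ] ℍ[ℝ] :=
  mvfderiv 𝓘(ℝ, ℂ) W x + (2⁻¹ : ℝ) • (((ContinuousLinearMap.mul ℝ ℍ[ℝ]).flip (W x)).comp (phiL f x)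
    - ((ContinuousLinearMap.mul ℝ ℍ[ℝ]) (W x)).comp (phiL f x))

theorem nablaT_add {U W : M → ℍ[ℝ]} (hU : DiffQ U x) (hW : DiffQ W x)
    (X : TangentSpace 𝓘(ℝ, ℂ) x) :
    nablaT f (fun y => U y + W y) x X = nablaT f U x X + nablaT f W x X := by
  simp only [nablaT]
  rw [mvfderiv_fun_add hU hW, add_apply, mul_add, add_mul]
  module

theorem nablaT_mul {U W : M → ℍ[ℝ]} (hU : DiffQ U x) (hW : DiffQ W x)
    (X : TangentSpace 𝓘(ℝ, ℂ) x) :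
    nablaT f (fun y => U y * W y) x X = nablaT f U x X * W x + U x * nablaT f W x X := by
  simp only [nablaT]
  rw [mvfderiv_quaternion_mul hU hW]
  simp only [add_mul, mul_add, smul_mul_assoc, mul_smul_comm, mul_sub, sub_mul, mul_assoc]
  module

theorem nablaT_smul {h : M → ℝ} {W : M → ℍ[ℝ]} (hh : MDifferentiableAt 𝓘(ℝ, ℂ) 𝓘(ℝ, ℝ) h x)
    (hW : DiffQ W x) (X : TangentSpace 𝓘(ℝ, ℂ) x) :
    nablaT f (fun y => h y • W y) x X
      = mvfderiv 𝓘(ℝ, ℂ) h x X • W x + h x • nablaT f W x X := by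
  simp only [nablaT]
  have h1 := mvfderiv_bilin (ContinuousLinearMap.lsmul ℝ ℝ (E := ℍ[ℝ])) hh hW X
  simp only [ContinuousLinearMap.lsmul_apply] at h1
  rw [h1, mul_smul_comm, smul_mul_assoc]
  module

/-- `nablaT` is metric: the commutator with the imaginary quaternion `φ(X)` is skew for the inner
product. -/
theorem mvfderiv_inner {U W : M → ℍ[ℝ]} (hf : IsConformalImmersion f) (hU : DiffQ U x)
    (hW : DiffQ W x) (X : TangentSpace 𝓘(ℝ, ℂ) x) :
    mvfderiv 𝓘(ℝ, ℂ) (fun y => (inner ℝ (U y) (W y) : ℝ)) x X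
      = inner ℝ (nablaT f U x X) (W x) + inner ℝ (U x) (nablaT f W x X) := by
  have h1 : mvfderiv 𝓘(ℝ, ℂ) (fun y => (inner ℝ (U y) (W y) : ℝ)) x X
      = inner ℝ (mvfderiv 𝓘(ℝ, ℂ) U x X) (W x) + inner ℝ (U x) (mvfderiv 𝓘(ℝ, ℂ) W x X) :=
    mvfderiv_bilin (innerSL ℝ (E := ℍ[ℝ])) hU hW X
  have h2 := phi_re hf X
  rw [h1]
  simp only [nablaT, Quaternion.inner_def]
  simp [h2]
  ring

theorem nablaT_re {W : M → ℍ[ℝ]} (hW : DiffQ W x) (hre : ∀ y, (W y).re = 0)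
    (X : TangentSpace 𝓘(ℝ, ℂ) x) : (nablaT f W x X).re = 0 := by
  have h1 := mvfderiv_clm (innerSL ℝ (1 : ℍ[ℝ])) hW X
  have h2 : (fun y => innerSL ℝ (1 : ℍ[ℝ]) (W y)) = fun _ => (0 : ℝ) := by
    funext y
    simp [Quaternion.inner_def, hre]
  rw [h2, mvfderiv_const, innerSL_apply_apply, Quaternion.inner_def] at h1
  have h3 : (0 : ℝ) = _ := h1
  simp at h3
  simp only [nablaT]
  simp [← h3]
  ring

/-- Quaternionic conjugation as a continuous linear map. -/
def starCL : ℍ[ℝ] →L[ℝ] ℍ[ℝ] :=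
  LinearMap.toContinuousLinearMap
    { toFun := star
      map_add' := star_add
      map_smul' := fun r p => by ext <;> simp }

theorem phi_eq_star_mul (Y : TangentSpace 𝓘(ℝ, ℂ) x) :
    phi f x Y = star (f x : ℍ[ℝ]) * mvfderiv 𝓘(ℝ, ℂ) (fun y => (f y : ℍ[ℝ])) x Y := by
  rw [phi, inv_coe_sphere]

variable [IsManifold 𝓘(ℂ) ω M]

theorem DiffVF.phi {Y : ∀ y : M, TangentSpace 𝓘(ℝ, ℂ) y} (hY : DiffVF Y x)
    (hf : IsConformalImmersion f) : DiffQ (fun y => phi f y (Y y)) x := by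
  simp only [phi_eq_star_mul]
  exact (mdifferentiableAt_clm starCL
    (hf.mdifferentiableAt_coe x)).mul (mdifferentiableAt_mvfderiv_apply hf.contMDiff_coe hY)

/-- Product rule for `φ = f̄ df`, with `df = fφ` and hence `d f̄ = -φ f̄`. -/
theorem mvfderiv_phi (hf : IsConformalImmersion f) {Y : ∀ y : M, TangentSpace 𝓘(ℝ, ℂ) y}
    (hY : DiffVF Y x) (X : TangentSpace 𝓘(ℝ, ℂ) x) :
    mvfderiv 𝓘(ℝ, ℂ) (fun y => phi f y (Y y)) x X
      = -(phi f x X * phi f x (Y x)) + star (f x : ℍ[ℝ]) * mvfderiv 𝓘(ℝ, ℂ)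
        (fun y => mvfderiv 𝓘(ℝ, ℂ) (fun y => (f y : ℍ[ℝ])) y (Y y)) x X := by
  have h1 : (fun y => phi f y (Y y)) = fun y => starCL (f y : ℍ[ℝ]) * mvfderiv 𝓘(ℝ, ℂ) (fun y => (f y : ℍ[ℝ])) y (Y y) :=
    funext fun y => phi_eq_star_mul (Y y)
  rw [h1, mvfderiv_quaternion_mul (mdifferentiableAt_clm _ (hf.mdifferentiableAt_coe x))
    (mdifferentiableAt_mvfderiv_apply hf.contMDiff_coe hY),
    mvfderiv_clm _ (hf.mdifferentiableAt_coe x)]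
  have h2 : ∀ Z : TangentSpace 𝓘(ℝ, ℂ) x, mvfderiv 𝓘(ℝ, ℂ) (fun y => (f y : ℍ[ℝ])) x Z
      = (f x : ℍ[ℝ]) * phi f x Z := fun Z => by
    rw [phi, mul_inv_cancel_left₀ (coe_sphere_ne_zero (f x))]
  have h3 : star (f x : ℍ[ℝ]) * (f x : ℍ[ℝ]) = 1 := by
    rw [← inv_coe_sphere, inv_mul_cancel₀ (coe_sphere_ne_zero (f x))]
  congr 1
  change star _ * _ = _
  rw [h2, h2, star_mul, star_eq_neg_of_re_eq_zero (phi_re hf X), mul_assoc, ← mul_assoc (star _),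
    h3, one_mul, neg_mul]

/-- The Maurer–Cartan equation: `φ` is torsion free. -/
theorem nablaT_phi_sub (hf : IsConformalImmersion f) {X Y : ∀ y : M, TangentSpace 𝓘(ℝ, ℂ) y}
    (hX : DiffVF X x) (hY : DiffVF Y x) :
    nablaT f (fun y => phi f y (Y y)) x (X x) - nablaT f (fun y => phi f y (X y)) x (Y x)
      = phi f x (VectorField.mlieBracket 𝓘(ℝ, ℂ) X Y x) := by
  simp only [nablaT]
  -- The terms `-φ(X)φ(Y) + ½[φ(X), φ(Y)]` are symmetric in `X` and `Y`, so they drop out and `d² =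
  -- 0` for `f` gives the bracket.
  rw [mvfderiv_phi hf hX, mvfderiv_phi hf hY, phi_eq_star_mul (VectorField.mlieBracket _ _ _ _),
    ← mvfderiv_mvfderiv_sub hf.contMDiff_coe hX hY, mul_sub]
  module

theorem exists_diffVF (X : TangentSpace 𝓘(ℝ, ℂ) x) :
    ∃ Y : ∀ y : M, TangentSpace 𝓘(ℝ, ℂ) y, DiffVF Y x ∧ Y x = X :=
  ⟨FiberBundle.extend ℂ X, FiberBundle.mdifferentiableAt_extend 𝓘(ℝ, ℂ) ℂ X, by simp⟩

/-- The definition of `R(y)` uses the preferred chart at `y`, which need not vary continuously. In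
one fixed chart, `R` is the quotient `b a⁻¹` of the values of `φ` on the two coordinate fields,
since `R φ(X) = φ(JX)` holds for every `X`. -/
theorem contMDiff_unitNormal (hf : IsConformalImmersion f) :
    ContMDiff 𝓘(ℝ, ℂ) 𝓘(ℝ, ℍ[ℝ]) ∞ (unitNormal f) := by
  intro x
  apply contMDiffAt_of_comp_chart_symm le_rfl
  set z₀ := extChartAt 𝓘(ℝ, ℂ) x x with hz₀
  set h : ℂ → ℍ[ℝ] := (fun y => (f y : ℍ[ℝ])) ∘ (extChartAt 𝓘(ℝ, ℂ) x).symm with hh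
  have hsm := contDiffAt_comp_chart_symm le_rfl hf.contMDiff_coe
    (mem_extChartAt_target (I := 𝓘(ℝ, ℂ)) x)
  have hd : ContDiffAt ℝ ∞ (fderiv ℝ h) z₀ := hsm.fderiv_right (m := ∞) le_rfl
  have hs : ContDiffAt ℝ ∞ (fun z => star (h z)) z₀ :=
    starCL.contDiff.contDiffAt.comp z₀ hsm
  set a : ℂ → ℍ[ℝ] := fun z => star (h z) * fderiv ℝ h z 1 with ha
  set b : ℂ → ℍ[ℝ] := fun z => star (h z) * fderiv ℝ h z Complex.I with hb
  have hasm : ContDiffAt ℝ ∞ a z₀ := hs.mul (hd.clm_apply contDiffAt_const)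
  have hbsm : ContDiffAt ℝ ∞ b z₀ := hs.mul (hd.clm_apply contDiffAt_const)
  have key : ∀ z ∈ (extChartAt 𝓘(ℝ, ℂ) x).target, a z ≠ 0 ∧
      unitNormal f ((extChartAt 𝓘(ℝ, ℂ) x).symm z) * a z = b z := by
    intro z hz
    set y := (extChartAt 𝓘(ℝ, ℂ) x).symm z with hy
    set L := mfderivWithin 𝓘(ℝ, ℂ) 𝓘(ℝ, ℂ) (extChartAt 𝓘(ℝ, ℂ) x).symm (Set.range 𝓘(ℝ, ℂ)) z
    have h1 : ∀ v : ℂ, star (h z) * fderiv ℝ h z v = phi f y (L v) := fun v => by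
      rw [phi_eq_star_mul, mvfderiv_comp_chart_symm hz (hf.mdifferentiableAt_coe _)]
      rfl
    have h2 : L Complex.I = rotJ (L (1 : ℂ)) := by
      have h3 := mfderivWithin_chart_symm_rotJ hz (1 : ℂ)
      rw [mul_one] at h3
      exact h3
    have h4 : L (1 : ℂ) ≠ 0 := fun h5 => by
      have h6 := (isInvertible_mfderivWithin_extChartAt_symm (I := 𝓘(ℝ, ℂ)) hz).injective
      exact one_ne_zero (α := ℂ) (h6 (h5.trans (map_zero L).symm))
    have ha' : a z = phi f y (L (1 : ℂ)) := h1 1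
    have hb' : b z = phi f y (rotJ (L (1 : ℂ))) := (h1 Complex.I).trans (congrArg _ h2)
    rw [ha', hb']
    exact ⟨phi_ne_zero hf h4, unitNormal_mul_phi hf _⟩
  -- This is `b a⁻¹`, with the inverse written as `ā / |a|²`.
  have hN : ContDiffAt ℝ ∞ (fun z => (‖a z‖ ^ 2)⁻¹ • (b z * star (a z))) z₀ := by
    have h1 : ContDiffAt ℝ ∞ (fun z => (‖a z‖ ^ 2)⁻¹) z₀ :=
      (hasm.norm_sq ℝ).inv (by
        have := (key z₀ (mem_extChartAt_target x)).1
        positivity)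
    exact h1.smul (hbsm.mul (starCL.contDiff.contDiffAt.comp z₀ hasm))
  refine hN.congr_of_eventuallyEq ?_
  filter_upwards [eventually_mem_target x] with z hz
  obtain ⟨h1, h2⟩ := key z hz
  rw [← h2, mul_assoc, Quaternion.self_mul_star, Quaternion.normSq_eq_norm_mul_self, ← sq,
    Quaternion.mul_coe_eq_smul, smul_smul, inv_mul_cancel₀, one_smul]
  · rfl
  · positivity

theorem diffQ_unitNormal (hf : IsConformalImmersion f) (x : M) : DiffQ (unitNormal f) x :=
  (contMDiff_unitNormal hf).mdifferentiable (by simp) x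

/-- The Levi-Civita connection of the induced metric: the tangential part of `nablaT`. -/
def leviCivita (hf : IsConformalImmersion f) :
    CovariantDerivative 𝓘(ℝ, ℂ) ℂ (fun x : M => TangentSpace 𝓘(ℝ, ℂ) x) where
  toFun Y x := (phiInv f x).comp (nablaTL f (fun y => phi f y (Y y)) x)
  isCovariantDerivativeOnUniv :=
    { add := by
        intro Y Z x hY hZ _
        ext1 X
        change phiInv f x (nablaT f _ x X) = phiInv f x (nablaT f _ x X)
          + phiInv f x (nablaT f _ x X)
        rw [← map_add, ← nablaT_add (DiffVF.phi hY hf) (DiffVF.phi hZ hf)]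
        simp only [Pi.add_apply, phi_add]
      leibniz := by
        intro Y h x hY hh _
        ext1 X
        change phiInv f x (nablaT f _ x X) = h x • phiInv f x (nablaT f _ x X)
          + mvfderiv 𝓘(ℝ, ℂ) h x X • Y x
        have h1 := nablaT_smul (f := f) hh (DiffVF.phi hY hf) X
        simp only [← phi_smul] at h1
        rw [← phiInv_phi hf (Y x), ← map_smul, ← map_smul, ← map_add, add_comm, ← phi_smul]
        exact congrArg _ h1 }

theorem leviCivita_apply (hf : IsConformalImmersion f) (Y : ∀ y : M, TangentSpace 𝓘(ℝ, ℂ) y)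
    (X : TangentSpace 𝓘(ℝ, ℂ) x) :
    leviCivita hf Y x X = phiInv f x (nablaT f (fun y => phi f y (Y y)) x X) := rfl

theorem isLeviCivita_leviCivita (hf : IsConformalImmersion f) :
    IsLeviCivita f (leviCivita hf) where
  torsion_zero := by
    rw [CovariantDerivative.torsion_eq_zero_iff]
    intro X Y x hX hY
    rw [leviCivita_apply, leviCivita_apply, ← map_sub, nablaT_phi_sub hf hX hY, phiInv_phi hf]
  metric_compat := by
    intro x Y Z hY hZ X
    rw [leviCivita_apply, leviCivita_apply]
    simp only [inducedMetric]
    rw [mvfderiv_inner hf (hY.phi hf) (hZ.phi hf), inner_phi_phiInv hf,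
      real_inner_comm (phi f x (phiInv f x _)), inner_phi_phiInv hf, real_inner_comm (phi f x (Y x))]

/-- The Gauss formula; the normal coefficient is the second fundamental form by
`II_eq_inner_nablaT`. -/
theorem phi_leviCivita (hf : IsConformalImmersion f) {Y : ∀ y : M, TangentSpace 𝓘(ℝ, ℂ) y}
    (hY : DiffVF Y x) (X : TangentSpace 𝓘(ℝ, ℂ) x) :
    nablaT f (fun y => phi f y (Y y)) x X = phi f x (leviCivita hf Y x X)
      + inner ℝ (unitNormal f x) (nablaT f (fun y => phi f y (Y y)) x X) • unitNormal f x :=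
  eq_phi_add_unitNormal hf (nablaT_re (hY.phi hf) (fun y => phi_re hf (Y y)) X)

/-- Uniqueness of the Levi-Civita connection. -/
theorem IsLeviCivita.eq_leviCivita (hf : IsConformalImmersion f)
    {D : CovariantDerivative 𝓘(ℝ, ℂ) ℂ (fun x : M => TangentSpace 𝓘(ℝ, ℂ) x)}
    (hD : IsLeviCivita f D) {Y : ∀ y : M, TangentSpace 𝓘(ℝ, ℂ) y} (hY : DiffVF Y x)
    (X : TangentSpace 𝓘(ℝ, ℂ) x) : D Y x X = leviCivita hf Y x X := by
  have h0 := isLeviCivita_leviCivita hf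
  have hadd : ∀ A B C : TangentSpace 𝓘(ℝ, ℂ) x, inducedMetric f x (A - B) C
      = inducedMetric f x A C - inducedMetric f x B C := fun A B C => by
    rw [inducedMetric, phi_sub, inner_sub_left]; rfl
  -- The difference of two torsion-free connections is symmetric; the difference of two metric ones
  -- is skew (`hskew`).
  have hsymm : ∀ {A B : ∀ y : M, TangentSpace 𝓘(ℝ, ℂ) y}, DiffVF A x → DiffVF B x →
      D A x (B x) - leviCivita hf A x (B x) = D B x (A x) - leviCivita hf B x (A x) := by
    intro A B hA hB
    have h1 := (CovariantDerivative.torsion_eq_zero_iff D).1 hD.torsion_zero hA hB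
    have h2 := (CovariantDerivative.torsion_eq_zero_iff _).1 h0.torsion_zero hA hB
    have h3 := h1.trans h2.symm
    rw [sub_eq_sub_iff_add_eq_add] at h3 ⊢
    rw [add_comm, ← h3, add_comm]
  have hskew : ∀ {A B : ∀ y : M, TangentSpace 𝓘(ℝ, ℂ) y}, DiffVF A x → DiffVF B x → ∀ Z,
      inducedMetric f x (D A x Z - leviCivita hf A x Z) (B x)
        = -inducedMetric f x (D B x Z - leviCivita hf B x Z) (A x) := by
    intro A B hA hB Z
    have h1 := hD.metric_compat x A B hA hB Z
    rw [h0.metric_compat x A B hA hB Z, inducedMetric_symm (A x), inducedMetric_symm (A x)] at h1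
    rw [hadd, hadd]
    linarith
  obtain ⟨A, hA, rfl⟩ := exists_diffVF X
  -- `Z` extends the difference vector itself, so its pairing with `Z` is a squared norm.
  obtain ⟨Z, hZ, hZx⟩ := exists_diffVF (D Y x (A x) - leviCivita hf Y x (A x))
  have h : inducedMetric f x (D Y x (A x) - leviCivita hf Y x (A x)) (Z x) = 0 := by
    -- Alternating the two symmetries three times permutes the arguments cyclically back to the
    -- start with total sign `-1`.
    have e1 := hskew hY hZ (A x)
    rw [hsymm hZ hA] at e1
    have e2 := hskew hA hY (Z x)
    rw [hsymm hY hZ] at e2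
    have e3 := hskew hZ hA (Y x)
    rw [hsymm hA hY] at e3
    linarith
  rw [hZx, inducedMetric, inner_self_eq_zero] at h
  exact sub_eq_zero.1 (phi_injective hf (h.trans (map_zero (phiL f x)).symm))

end LeviCivita

/-! ### The second fundamental form -/

section SecondFundamentalForm

variable {M : Type*} [TopologicalSpace M] [ChartedSpace ℂ M]
  {f : M → S3} {x : M}

/-- The covariant derivative of the unit normal. -/
abbrev nablaNormal (f : M → S3) (x : M) (X : TangentSpace 𝓘(ℝ, ℂ) x) : ℍ[ℝ] :=
  nablaT f (unitNormal f) x X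

theorem nablaNormal_add (X Y : TangentSpace 𝓘(ℝ, ℂ) x) :
    nablaNormal f x (X + Y) = nablaNormal f x X + nablaNormal f x Y :=
  map_add (nablaTL f (unitNormal f) x) X Y

theorem nablaNormal_smul (r : ℝ) (X : TangentSpace 𝓘(ℝ, ℂ) x) :
    nablaNormal f x (r • X) = r • nablaNormal f x X :=
  map_smul (nablaTL f (unitNormal f) x) r X

theorem II_add_left (X Y Z : TangentSpace 𝓘(ℝ, ℂ) x) :
    II f x (X + Y) Z = II f x X Z + II f x Y Z := by
  have h : inner ℝ (nablaNormal f x (X + Y)) (phi f x Z)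
      = inner ℝ (nablaNormal f x X) (phi f x Z) + inner ℝ (nablaNormal f x Y) (phi f x Z) := by
    rw [nablaNormal_add, inner_add_left]
  simp only [II, nablaNormal] at h ⊢
  linarith

theorem II_add_right (X Y Z : TangentSpace 𝓘(ℝ, ℂ) x) :
    II f x X (Y + Z) = II f x X Y + II f x X Z := by
  simp only [II, phi_add, inner_add_right]
  ring

theorem II_smul_left (r : ℝ) (X Y : TangentSpace 𝓘(ℝ, ℂ) x) :
    II f x (r • X) Y = r * II f x X Y := by
  have h : inner ℝ (nablaNormal f x (r • X)) (phi f x Y)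
      = r * inner ℝ (nablaNormal f x X) (phi f x Y) := by
    rw [nablaNormal_smul, real_inner_smul_left]
  simp only [II, nablaNormal] at h ⊢
  linarith

theorem II_smul_right (r : ℝ) (X Y : TangentSpace 𝓘(ℝ, ℂ) x) :
    II f x X (r • Y) = r * II f x X Y := by
  simp only [II, phi_smul, real_inner_smul_right]
  ring

theorem II_neg_right (X Y : TangentSpace 𝓘(ℝ, ℂ) x) : II f x X (-Y) = -II f x X Y := by
  simp only [II, phi_neg, inner_neg_right]

/-- Minimality is stated for orthonormal pairs; `X` and `JX` form one after division by `|X|`, and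
the factor `|X|⁻²` cancels. -/
theorem II_self_add_rotJ (hf : IsConformalImmersion f) (hmin : IsMinimal f)
    (X : TangentSpace 𝓘(ℝ, ℂ) x) : II f x X X + II f x (rotJ X) (rotJ X) = 0 := by
  by_cases hX : X = 0
  · have h0 : X = (0 : ℝ) • X := by rw [zero_smul, hX]
    rw [h0, rotJ_smul, II_smul_left, II_smul_left]
    ring
  set n := inducedMetric f x X X with hn
  have hpos : 0 < n := by
    have h := phi_ne_zero hf hX
    rw [hn, inducedMetric, real_inner_self_eq_norm_sq]
    positivity
  have hsmul : ∀ (r : ℝ) (A B : TangentSpace 𝓘(ℝ, ℂ) x),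
      inducedMetric f x (r • A) (r • B) = r ^ 2 * inducedMetric f x A B := fun r A B => by
    simp only [inducedMetric, phi_smul, real_inner_smul_left, real_inner_smul_right]
    ring
  have hr : (√n)⁻¹ ^ 2 * n = 1 := by
    rw [inv_pow, Real.sq_sqrt hpos.le, inv_mul_cancel₀ hpos.ne']
  have hJ : inducedMetric f x X (rotJ X) = 0 := by
    have h1 := volForm_eq_inducedMetric hf X X
    have h2 := volForm_swap (f := f) X X
    linarith
  have h := hmin x ((√n)⁻¹ • X) ((√n)⁻¹ • rotJ X) (by rw [hsmul, hr])
    (by rw [hsmul, hf.conformal, hr]) (by rw [hsmul, hJ, mul_zero])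
  simp only [II_smul_left, II_smul_right] at h
  have h3 : (√n)⁻¹ ≠ 0 := inv_ne_zero (Real.sqrt_pos.2 hpos).ne'
  have h4 : (√n)⁻¹ * (√n)⁻¹ * (II f x X X + II f x (rotJ X) (rotJ X)) = 0 := by linarith
  exact (mul_eq_zero.1 h4).resolve_left (mul_ne_zero h3 h3)

variable [IsManifold 𝓘(ℂ) ω M]

theorem nablaNormal_re (hf : IsConformalImmersion f) (X : TangentSpace 𝓘(ℝ, ℂ) x) :
    (nablaNormal f x X).re = 0 :=
  nablaT_re (diffQ_unitNormal hf x) (unitNormal_re f) X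

/-- The derivative of `R² = -1`. Anticommuting with `R` means being orthogonal to it, so `∇R` is
tangential. -/
theorem nablaNormal_mul_unitNormal (hf : IsConformalImmersion f) (X : TangentSpace 𝓘(ℝ, ℂ) x) :
    nablaNormal f x X * unitNormal f x = -(unitNormal f x * nablaNormal f x X) := by
  have h := nablaT_mul (f := f) (diffQ_unitNormal hf x) (diffQ_unitNormal hf x) X
  simp only [unitNormal_mul_self hf] at h
  rw [nablaT, mvfderiv_const] at h
  rw [eq_neg_iff_add_eq_zero, ← h]
  simp

theorem phi_phiInv_nablaNormal (hf : IsConformalImmersion f) (X : TangentSpace 𝓘(ℝ, ℂ) x) :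
    phi f x (phiInv f x (nablaNormal f x X)) = nablaNormal f x X := by
  have h := eq_phi_add_unitNormal (x := x) hf (nablaNormal_re hf X)
  rw [real_inner_comm, inner_eq_zero_of_mul_swap (nablaNormal_re hf X) (unitNormal_re f x)
    (nablaNormal_mul_unitNormal hf X), zero_smul, add_zero] at h
  exact h.symm

/-- With `∇_X R = φ(W)`, this is `phi_mul_phi` for `W` and `Y`: one has `-g(W,Y) = II(X,Y)` and
`vol(W,Y) = -g(W,JY) = II(X,JY)`. -/
theorem nablaNormal_mul_phi (hf : IsConformalImmersion f) (X Y : TangentSpace 𝓘(ℝ, ℂ) x) :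
    nablaNormal f x X * phi f x Y
      = ((II f x X Y : ℝ) : ℍ[ℝ]) + II f x X (rotJ Y) • unitNormal f x := by
  rw [← phi_phiInv_nablaNormal hf, phi_mul_phi hf, volForm_eq_inducedMetric hf]
  simp only [inducedMetric, phi_phiInv_nablaNormal hf]
  rfl

/-- Differentiate `⟨R, φ(Y)⟩ = 0`. -/
theorem II_eq_inner_nablaT (hf : IsConformalImmersion f)
    {Y : ∀ y : M, TangentSpace 𝓘(ℝ, ℂ) y} (hY : DiffVF Y x) (X : TangentSpace 𝓘(ℝ, ℂ) x) :
    II f x X (Y x) = inner ℝ (unitNormal f x) (nablaT f (fun y => phi f y (Y y)) x X) := by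
  have h := mvfderiv_inner hf (diffQ_unitNormal hf x) (hY.phi hf) X
  simp only [inner_unitNormal_phi hf] at h
  rw [mvfderiv_const] at h
  have h1 : (0 : ℝ) = _ := h
  rw [II]
  linarith

/-- The skew part is the normal component of the torsion identity, whose right side `φ([X,Y])` is
tangential. -/
theorem II_symm (hf : IsConformalImmersion f) (X Y : TangentSpace 𝓘(ℝ, ℂ) x) :
    II f x X Y = II f x Y X := by
  obtain ⟨A, hA, rfl⟩ := exists_diffVF X
  obtain ⟨B, hB, rfl⟩ := exists_diffVF Y
  rw [II_eq_inner_nablaT hf hB, II_eq_inner_nablaT hf hA, ← sub_eq_zero, ← inner_sub_right,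
    nablaT_phi_sub hf hA hB, inner_unitNormal_phi hf]

/-- Polarisation of the trace condition, using the symmetry of `II`. -/
theorem II_rotJ_rotJ (hf : IsConformalImmersion f) (hmin : IsMinimal f)
    (X Y : TangentSpace 𝓘(ℝ, ℂ) x) : II f x (rotJ X) (rotJ Y) = -II f x X Y := by
  have h := II_self_add_rotJ hf hmin (X + Y)
  have hX := II_self_add_rotJ hf hmin X
  have hY := II_self_add_rotJ hf hmin Y
  rw [rotJ_add] at h
  simp only [II_add_left, II_add_right] at h
  rw [II_symm hf Y X, II_symm hf (rotJ Y) (rotJ X)] at h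
  linarith

theorem II_rotJ_left (hf : IsConformalImmersion f) (hmin : IsMinimal f)
    (X Y : TangentSpace 𝓘(ℝ, ℂ) x) : II f x (rotJ X) Y = II f x X (rotJ Y) := by
  have h := II_rotJ_rotJ hf hmin X (rotJ Y)
  rw [rotJ_rotJ, II_neg_right] at h
  linarith

theorem hopf_eq (hf : IsConformalImmersion f) (hmin : IsMinimal f)
    (X Y : TangentSpace 𝓘(ℝ, ℂ) x) :
    hopf f x X Y = (2⁻¹ : ℂ) * ((II f x X Y : ℂ) - Complex.I * (II f x X (rotJ Y) : ℂ)) := by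
  rw [hopf, II_rotJ_rotJ hf hmin, II_rotJ_left hf hmin]
  push_cast
  ring

/-- The point at which minimality makes the Higgs field holomorphic. -/
theorem nablaNormal_mul_phi_symm (hf : IsConformalImmersion f) (hmin : IsMinimal f)
    (X Y : TangentSpace 𝓘(ℝ, ℂ) x) :
    nablaNormal f x X * phi f x Y = nablaNormal f x Y * phi f x X := by
  rw [nablaNormal_mul_phi hf, nablaNormal_mul_phi hf, II_symm hf Y X, II_symm hf Y (rotJ X),
    II_rotJ_left hf hmin]

end SecondFundamentalForm

/-! ### The splitting of the spinor bundle -/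

section Splitting

theorem detForm_eq_zero {v s : Spinor} (hs : s ≠ 0) (h : detForm v s = 0) :
    ∃ c : ℂ, v = c • s := by
  rw [detForm, sub_eq_zero] at h
  by_cases h0 : s 0 = 0
  · have h1 : s 1 ≠ 0 := fun h1 => hs (by ext i; fin_cases i <;> simp [h0, h1])
    refine ⟨v 1 / s 1, ?_⟩
    have h2 : v 0 = 0 := by
      rw [h0, mul_zero] at h
      exact (mul_eq_zero.1 h).resolve_right h1
    ext i
    fin_cases i <;> simp [h0, h1, h2]
  · refine ⟨v 0 / s 0, ?_⟩
    ext i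
    fin_cases i <;> simp <;> field_simp
    linear_combination -h

variable {M : Type*} [TopologicalSpace M] [ChartedSpace ℂ M] {f : M → S3} {x : M}

theorem cliff_unitNormal_sq (hf : IsConformalImmersion f) (v : Spinor) :
    cliff (unitNormal f x) (cliff (unitNormal f x) v) = -v := by
  rw [← cliff_mul, unitNormal_mul_self hf, cliff_neg, cliff_one]
  rfl

theorem cliff_phi_unitNormal (hf : IsConformalImmersion f) (X : TangentSpace 𝓘(ℝ, ℂ) x)
    (v : Spinor) : cliff (phi f x X) (cliff (unitNormal f x) v)
      = -cliff (unitNormal f x) (cliff (phi f x X) v) := by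
  rw [← cliff_mul, phi_mul_unitNormal hf, cliff_neg, ← cliff_mul]
  rfl

theorem cliff_injective {p : ℍ[ℝ]} (hp : p ≠ 0) : Function.Injective (cliff p) := by
  intro v w h
  have h1 := congrArg (cliff p⁻¹) h
  rwa [← cliff_mul, ← cliff_mul, inv_mul_cancel₀ hp, cliff_one] at h1

theorem higgs_apply (hf : IsConformalImmersion f) (X : TangentSpace 𝓘(ℝ, ℂ) x) (v : Spinor) :
    higgs f x X v = (4⁻¹ : ℂ) • (cliff (phi f x X) v
      - Complex.I • cliff (unitNormal f x) (cliff (phi f x X) v)) := by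
  rw [← cliff_mul, unitNormal_mul_phi hf]
  rfl

/-- Moving `R` past `φ(X)` changes its sign. In this form the kernel is visible, since `φ(X)` is
invertible for `X ≠ 0`. -/
theorem higgs_apply' (hf : IsConformalImmersion f) (X : TangentSpace 𝓘(ℝ, ℂ) x) (v : Spinor) :
    higgs f x X v = (4⁻¹ : ℂ) • cliff (phi f x X)
      (v + Complex.I • cliff (unitNormal f x) v) := by
  rw [higgs_apply hf, map_add, map_smul, cliff_phi_unitNormal hf, smul_neg, sub_eq_add_neg]

theorem mem_spinSinv (hf : IsConformalImmersion f) {v : Spinor} :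
    v ∈ spinSinv f x ↔ cliff (unitNormal f x) v = Complex.I • v := by
  have key : ∀ w : Spinor, v + Complex.I • w = 0 ↔ w = Complex.I • v := by
    intro w
    constructor
    · intro h
      have h1 := congrArg (Complex.I • ·) h
      simp only [smul_add, smul_smul, Complex.I_mul_I, smul_zero, neg_smul, one_smul] at h1
      exact (sub_eq_zero.1 ((sub_eq_add_neg _ _).trans h1)).symm
    · rintro rfl
      simp [smul_smul]
  rw [← key]
  simp only [spinSinv, Submodule.mem_iInf, LinearMap.mem_ker, ContinuousLinearMap.coe_coe,
    higgs_apply' hf]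
  constructor
  · intro h
    have h1 := (smul_eq_zero.1 (h (coordRe x))).resolve_left (by norm_num)
    exact cliff_injective (phi_ne_zero hf (coordRe_ne_zero x)) (h1.trans (map_zero _).symm)
  · intro h X
    rw [h, map_zero, smul_zero]

/-- The orthogonal projection onto `S⁻¹`. -/
def projSinv (f : M → S3) (x : M) : Spinor →L[ℂ] Spinor :=
  (2⁻¹ : ℂ) • (1 - Complex.I • cliff (unitNormal f x))

/-- The orthogonal projection onto `S`. -/
def projS (f : M → S3) (x : M) : Spinor →L[ℂ] Spinor :=
  (2⁻¹ : ℂ) • (1 + Complex.I • cliff (unitNormal f x))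

theorem projSinv_apply (v : Spinor) :
    projSinv f x v = (2⁻¹ : ℂ) • (v - Complex.I • cliff (unitNormal f x) v) := rfl

theorem projS_apply (v : Spinor) :
    projS f x v = (2⁻¹ : ℂ) • (v + Complex.I • cliff (unitNormal f x) v) := rfl

theorem projSinv_add_projS (v : Spinor) : projSinv f x v + projS f x v = v := by
  rw [projSinv_apply, projS_apply]
  module

theorem cliff_projSinv (hf : IsConformalImmersion f) (v : Spinor) :
    cliff (unitNormal f x) (projSinv f x v) = Complex.I • projSinv f x v := by
  rw [projSinv_apply, map_smul, map_sub, map_smul, cliff_unitNormal_sq hf, smul_comm,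
    smul_sub Complex.I, smul_smul Complex.I, Complex.I_mul_I]
  module

theorem cliff_projS (hf : IsConformalImmersion f) (v : Spinor) :
    cliff (unitNormal f x) (projS f x v) = -(Complex.I • projS f x v) := by
  rw [projS_apply, map_smul, map_add, map_smul, cliff_unitNormal_sq hf, smul_comm,
    smul_add Complex.I, smul_smul Complex.I, Complex.I_mul_I]
  module

theorem projSinv_mem (hf : IsConformalImmersion f) (v : Spinor) :
    projSinv f x v ∈ spinSinv f x := (mem_spinSinv hf).2 (cliff_projSinv hf v)

theorem inner_cliff_unitNormal (v w : Spinor) :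
    inner ℂ v (cliff (unitNormal f x) w) = -inner ℂ (cliff (unitNormal f x) v) w := by
  rw [← ContinuousLinearMap.adjoint_inner_left, adjoint_cliff (unitNormal_re f x),
    neg_apply, inner_neg_left]

/-- Eigenspaces of a skew-Hermitian map are orthogonal. Conversely, a vector orthogonal to `S⁻¹` has
vanishing `projSinv`-component. -/
theorem mem_spinS (hf : IsConformalImmersion f) {v : Spinor} :
    v ∈ spinS f x ↔ cliff (unitNormal f x) v = -(Complex.I • v) := by
  constructor
  · intro h
    have h1 : projSinv f x v = 0 := by
      have h2 : inner ℂ (projSinv f x v) v = 0 := h _ (projSinv_mem hf v)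
      have h3 : inner ℂ (projSinv f x v) (cliff (unitNormal f x) v) = 0 := by
        rw [inner_cliff_unitNormal, cliff_projSinv hf, inner_smul_left, h2, mul_zero, neg_zero]
      -- For `P = ½(1 - iR)`, expanding the second factor of `⟨Pv, Pv⟩` leaves multiples of `⟨Pv,
      -- v⟩` and `⟨Pv, Rv⟩`, both zero.
      rw [← inner_self_eq_zero (𝕜 := ℂ)]
      nth_rw 2 [projSinv_apply]
      rw [inner_smul_right, inner_sub_right, inner_smul_right, h2, h3]
      simp
    have h4 := projSinv_add_projS (f := f) (x := x) v
    rw [h1, zero_add] at h4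
    have h5 := cliff_projS (x := x) hf v
    rwa [h4] at h5
  · intro h t ht
    have h1 := inner_cliff_unitNormal (f := f) (x := x) t v
    rw [h, (mem_spinSinv hf).1 ht, inner_neg_right, inner_smul_left, inner_smul_right,
      Complex.conj_I] at h1
    have h2 : 2 * Complex.I * inner ℂ t v = 0 := by linear_combination -h1
    exact (mul_eq_zero.1 h2).resolve_left (mul_ne_zero two_ne_zero Complex.I_ne_zero)

theorem projS_mem (hf : IsConformalImmersion f) (v : Spinor) :
    projS f x v ∈ spinS f x := (mem_spinS hf).2 (cliff_projS hf v)

theorem projSinv_of_mem (hf : IsConformalImmersion f) {v : Spinor} (hv : v ∈ spinSinv f x) :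
    projSinv f x v = v := by
  rw [projSinv_apply, (mem_spinSinv hf).1 hv, smul_smul, Complex.I_mul_I]
  module

theorem projSinv_of_mem_spinS (hf : IsConformalImmersion f) {v : Spinor} (hv : v ∈ spinS f x) :
    projSinv f x v = 0 := by
  rw [projSinv_apply, (mem_spinS hf).1 hv, smul_neg, smul_smul, Complex.I_mul_I]
  module

theorem projS_of_mem (hf : IsConformalImmersion f) {v : Spinor} (hv : v ∈ spinS f x) :
    projS f x v = v := by
  rw [projS_apply, (mem_spinS hf).1 hv, smul_neg, smul_smul, Complex.I_mul_I]
  module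

theorem starProjection_spinSinv (hf : IsConformalImmersion f) (x : M) :
    (spinSinv f x).starProjection = projSinv f x := by
  ext1 v
  apply Submodule.eq_starProjection_of_mem_orthogonal (projSinv_mem hf v)
  nth_rw 1 [← projSinv_add_projS (f := f) (x := x) v]
  rw [add_sub_cancel_left]
  exact projS_mem hf v

theorem eq_zero_of_mem (hf : IsConformalImmersion f) {v : Spinor} (h1 : v ∈ spinSinv f x)
    (h2 : v ∈ spinS f x) : v = 0 := by
  rw [← projSinv_of_mem hf h1, projSinv_of_mem_spinS hf h2]

/-- A quaternion which anticommutes with the unit normal interchanges `S` and `S⁻¹`. -/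
theorem cliff_mem_spinSinv (hf : IsConformalImmersion f) {p : ℍ[ℝ]}
    (hp : p * unitNormal f x = -(unitNormal f x * p)) {s : Spinor} (hs : s ∈ spinS f x) :
    cliff p s ∈ spinSinv f x := by
  have h : unitNormal f x * p = -(p * unitNormal f x) := by rw [hp, neg_neg]
  rw [mem_spinSinv hf, ← cliff_mul, h, cliff_neg, neg_apply, cliff_mul, (mem_spinS hf).1 hs,
    map_neg, map_smul, neg_neg]

theorem cliff_mem_spinS (hf : IsConformalImmersion f) {p : ℍ[ℝ]}
    (hp : p * unitNormal f x = -(unitNormal f x * p)) {t : Spinor} (ht : t ∈ spinSinv f x) :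
    cliff p t ∈ spinS f x := by
  have h : unitNormal f x * p = -(p * unitNormal f x) := by rw [hp, neg_neg]
  rw [mem_spinS hf, ← cliff_mul, h, cliff_neg, neg_apply, cliff_mul, (mem_spinSinv hf).1 ht,
    map_smul]

/-- Clifford multiplication by a nonzero tangent vector is injective and exchanges the two
eigenspaces, so their dimensions agree; they add up to `2`. -/
theorem finrank_spin (hf : IsConformalImmersion f) (x : M) :
    Module.finrank ℂ (spinSinv f x) = 1 ∧ Module.finrank ℂ (spinS f x) = 1 := by
  have hsum : Module.finrank ℂ (spinSinv f x) + Module.finrank ℂ (spinS f x) = 2 := by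
    rw [spinS, Submodule.finrank_add_finrank_orthogonal, finrank_euclideanSpace_fin]
  have hinj := cliff_injective (phi_ne_zero hf (coordRe_ne_zero x))
  have h1 : Module.finrank ℂ (spinSinv f x) ≤ Module.finrank ℂ (spinS f x) := by
    rw [(Submodule.equivMapOfInjective (cliff (phi f x (coordRe x))).toLinearMap hinj
      (spinSinv f x)).finrank_eq]
    apply Submodule.finrank_mono
    rintro _ ⟨t, ht, rfl⟩
    exact cliff_mem_spinS hf (phi_mul_unitNormal hf _) ht
  have h2 : Module.finrank ℂ (spinS f x) ≤ Module.finrank ℂ (spinSinv f x) := by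
    rw [(Submodule.equivMapOfInjective (cliff (phi f x (coordRe x))).toLinearMap hinj
      (spinS f x)).finrank_eq]
    apply Submodule.finrank_mono
    rintro _ ⟨t, ht, rfl⟩
    exact cliff_mem_spinSinv hf (phi_mul_unitNormal hf _) ht
  omega

theorem exists_mem_spinS (hf : IsConformalImmersion f) (x : M) : ∃ s ∈ spinS f x, s ≠ 0 := by
  apply Submodule.exists_mem_ne_zero_of_ne_bot
  intro h
  have h1 := (finrank_spin hf x).2
  rw [h, finrank_bot] at h1
  exact zero_ne_one h1

/-! ### The Higgs field on the splitting -/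

theorem higgs_of_mem_spinSinv {t : Spinor} (ht : t ∈ spinSinv f x)
    (Y : TangentSpace 𝓘(ℝ, ℂ) x) : higgs f x Y t = 0 := by
  simp only [spinSinv, Submodule.mem_iInf] at ht
  exact ht Y

theorem higgs_of_mem_spinS (hf : IsConformalImmersion f) {s : Spinor} (hs : s ∈ spinS f x)
    (Y : TangentSpace 𝓘(ℝ, ℂ) x) : higgs f x Y s = (2⁻¹ : ℂ) • cliff (phi f x Y) s := by
  rw [higgs_apply' hf, (mem_spinS hf).1 hs, smul_neg, smul_smul, Complex.I_mul_I, neg_smul,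
    one_smul, neg_neg, map_add]
  module

theorem higgs_mem_spinSinv (hf : IsConformalImmersion f) {s : Spinor} (hs : s ∈ spinS f x)
    (Y : TangentSpace 𝓘(ℝ, ℂ) x) : higgs f x Y s ∈ spinSinv f x := by
  rw [higgs_of_mem_spinS hf hs]
  exact Submodule.smul_mem _ _ (cliff_mem_spinSinv hf (phi_mul_unitNormal hf Y) hs)

/-- Nondegeneracy of the pairing of `S⁻¹` with `S`: a zero determinant puts `t` on the line of `s`,
inside `S`. -/
theorem detForm_ne_zero (hf : IsConformalImmersion f) {t s : Spinor} (ht : t ∈ spinSinv f x)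
    (hs : s ∈ spinS f x) (hs0 : s ≠ 0) (h : detForm t s = 0) : t = 0 := by
  obtain ⟨c, rfl⟩ := detForm_eq_zero hs0 h
  exact eq_zero_of_mem hf ht (Submodule.smul_mem _ _ hs)

/-- `R` has trace zero, yet acts on `S ⊗ S` as a derivation by `-2i`. -/
theorem detForm_spinS (hf : IsConformalImmersion f) {s₁ s₂ : Spinor} (h₁ : s₁ ∈ spinS f x)
    (h₂ : s₂ ∈ spinS f x) : detForm s₁ s₂ = 0 := by
  have h := detForm_cliff_add (unitNormal f x) s₁ s₂
  rw [(mem_spinS hf).1 h₁, (mem_spinS hf).1 h₂, unitNormal_re, ← neg_smul, ← neg_smul,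
    detForm_smul_left, detForm_smul_right] at h
  simpa using h

theorem detForm_spinSinv (hf : IsConformalImmersion f) {s₁ s₂ : Spinor} (h₁ : s₁ ∈ spinSinv f x)
    (h₂ : s₂ ∈ spinSinv f x) : detForm s₁ s₂ = 0 := by
  have h := detForm_cliff_add (unitNormal f x) s₁ s₂
  rw [(mem_spinSinv hf).1 h₁, (mem_spinSinv hf).1 h₂, unitNormal_re,
    detForm_smul_left, detForm_smul_right] at h
  simpa using h

theorem sqForm_ne_zero (hf : IsConformalImmersion f) {s₁ s₂ : Spinor} (h₁ : s₁ ∈ spinS f x)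
    (h₂ : s₂ ∈ spinS f x) {Y : TangentSpace 𝓘(ℝ, ℂ) x} (hY : Y ≠ 0) (h0 : s₂ ≠ 0)
    (h : sqForm f x s₁ s₂ Y = 0) : s₁ = 0 := by
  have h3 := detForm_ne_zero hf (higgs_mem_spinSinv hf h₁ Y) h₂ h0 h
  rw [higgs_of_mem_spinS hf h₁] at h3
  exact cliff_injective (phi_ne_zero hf hY)
    (((smul_eq_zero.1 h3).resolve_left (by norm_num)).trans (map_zero _).symm)

/-- `φ(Y)` is trace-free, hence skew for `detForm`, and `detForm` is itself alternating. -/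
theorem sqForm_symm (hf : IsConformalImmersion f) {s₁ s₂ : Spinor} (h₁ : s₁ ∈ spinS f x)
    (h₂ : s₂ ∈ spinS f x) (Y : TangentSpace 𝓘(ℝ, ℂ) x) :
    sqForm f x s₁ s₂ Y = sqForm f x s₂ s₁ Y := by
  have h := detForm_cliff_add (phi f x Y) s₁ s₂
  rw [phi_re hf, detForm_swap s₁ (cliff _ s₂)] at h
  simp only [sqForm]
  rw [higgs_of_mem_spinS hf h₁, higgs_of_mem_spinS hf h₂, detForm_smul_left, detForm_smul_left]
  simp at h
  linear_combination 2⁻¹ * h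

theorem higgsAdj_apply (hf : IsConformalImmersion f) (X : TangentSpace 𝓘(ℝ, ℂ) x)
    (v : Spinor) : higgsAdj f x X v = -((4⁻¹ : ℂ) • (cliff (phi f x X) v
      + Complex.I • cliff (unitNormal f x) (cliff (phi f x X) v))) := by
  rw [← cliff_mul, unitNormal_mul_phi hf]
  have h : higgsAdj f x X = (4⁻¹ : ℂ) • (-cliff (phi f x X)
      + Complex.I • -cliff (phi f x (rotJ X))) := by
    rw [higgsAdj, higgs, map_smulₛₗ, map_sub, map_smulₛₗ, adjoint_cliff (phi_re hf _),
      adjoint_cliff (phi_re hf _), Complex.conj_I, neg_smul, sub_neg_eq_add, map_inv₀, map_ofNat, smul_neg]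
  rw [h]
  simp only [smul_apply, add_apply, neg_apply]
  module

theorem higgsAdj_of_mem_spinS (hf : IsConformalImmersion f) {s : Spinor} (hs : s ∈ spinS f x)
    (X : TangentSpace 𝓘(ℝ, ℂ) x) : higgsAdj f x X s = 0 := by
  rw [higgsAdj_apply hf, (mem_spinSinv hf).1 (cliff_mem_spinSinv hf (phi_mul_unitNormal hf X) hs),
    smul_smul, Complex.I_mul_I]
  module

theorem higgsAdj_of_mem_spinSinv (hf : IsConformalImmersion f) {t : Spinor}
    (ht : t ∈ spinSinv f x) (X : TangentSpace 𝓘(ℝ, ℂ) x) :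
    higgsAdj f x X t = -((2⁻¹ : ℂ) • cliff (phi f x X) t) := by
  rw [higgsAdj_apply hf, (mem_spinS hf).1 (cliff_mem_spinS hf (phi_mul_unitNormal hf X) ht),
    smul_neg, smul_smul, Complex.I_mul_I]
  module

theorem higgsAdj_mem_spinS (hf : IsConformalImmersion f) {t : Spinor}
    (ht : t ∈ spinSinv f x) (X : TangentSpace 𝓘(ℝ, ℂ) x) : higgsAdj f x X t ∈ spinS f x := by
  rw [higgsAdj_of_mem_spinSinv hf ht]
  exact Submodule.neg_mem _ (Submodule.smul_mem _ _
    (cliff_mem_spinS hf (phi_mul_unitNormal hf X) ht))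

/-- On `S` the composition is `-¼φ(X)φ(Y)`, and `R` acts there as `-i`. -/
theorem higgsAdj_higgs (hf : IsConformalImmersion f) {s : Spinor} (hs : s ∈ spinS f x)
    (X Y : TangentSpace 𝓘(ℝ, ℂ) x) : higgsAdj f x X (higgs f x Y s)
      = ((4⁻¹ : ℂ) * (inducedMetric f x X Y + Complex.I * volForm f x X Y)) • s := by
  rw [higgsAdj_of_mem_spinSinv hf (higgs_mem_spinSinv hf hs Y), higgs_of_mem_spinS hf hs,
    map_smul, ← cliff_mul, phi_mul_phi hf, cliff_add, cliff_coe, cliff_smul]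
  simp only [add_apply, smul_apply, (mem_spinS hf).1 hs]
  rw [one_apply_eq_self]
  push_cast
  module

/-- The image under `K̄ ⊗ K → Λ²`: antisymmetrising kills `g` and doubles `vol`. -/
theorem higgsAdj_higgs_sub (hf : IsConformalImmersion f) {s : Spinor} (hs : s ∈ spinS f x)
    (X Y : TangentSpace 𝓘(ℝ, ℂ) x) :
    higgsAdj f x X (higgs f x Y s) - higgsAdj f x Y (higgs f x X s)
      = (Complex.I / 2 * volForm f x X Y) • s := by
  rw [higgsAdj_higgs hf hs, higgsAdj_higgs hf hs, inducedMetric_symm Y X, volForm_swap Y X]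
  push_cast
  module

end Splitting

/-! ### The spin connection -/

section SpinConnection

variable {M : Type*} [TopologicalSpace M] [ChartedSpace ℂ M] {f : M → S3} {x : M}

/-- `nablaV` as a continuous linear map on each tangent space. -/
def nablaVL (f : M → S3) (ψ : M → Spinor) (x : M) : TangentSpace 𝓘(ℝ, ℂ) x →L[ℝ] Spinor :=
  mvfderiv 𝓘(ℝ, ℂ) ψ x + (2⁻¹ : ℝ) • (cliffEvalL.flip (ψ x)).comp (phiL f x)

theorem nablaVL_apply (ψ : M → Spinor) (X : TangentSpace 𝓘(ℝ, ℂ) x) :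
    nablaVL f ψ x X = nablaV f ψ x X := by
  have h : nablaVL f ψ x X
    = mvfderiv 𝓘(ℝ, ℂ) ψ x X + (2⁻¹ : ℝ) • cliff (phi f x X) (ψ x) := rfl
  have h2 : ∀ v : Spinor, (2⁻¹ : ℝ) • v = (2⁻¹ : ℂ) • v := fun v => by
    rw [← Complex.coe_smul]
    push_cast
    rfl
  rw [h, nablaV, h2]

theorem DiffQ.cliff_apply {W : M → ℍ[ℝ]} {ψ : M → Spinor} (hW : DiffQ W x) (hψ : DiffV ψ x) :
    DiffV (fun y => cliff (W y) (ψ y)) x := by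
  simp only [← cliffEvalL_apply]
  exact mdifferentiableAt_bilin cliffEvalL hW hψ

theorem DiffV.clm {ψ : M → Spinor} (hψ : DiffV ψ x) (L : Spinor →L[ℂ] Spinor) :
    DiffV (fun y => L (ψ y)) x :=
  mdifferentiableAt_clm (L.restrictScalars ℝ) hψ

theorem DiffV.const_smul {ψ : M → Spinor} (hψ : DiffV ψ x) (c : ℂ) :
    DiffV (fun y => c • ψ y) x :=
  hψ.clm (c • ContinuousLinearMap.id ℂ Spinor)

theorem DiffV.add {ψ χ : M → Spinor} (hψ : DiffV ψ x) (hχ : DiffV χ x) :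
    DiffV (fun y => ψ y + χ y) x := MDifferentiableAt.add hψ hχ

theorem DiffV.sub {ψ χ : M → Spinor} (hψ : DiffV ψ x) (hχ : DiffV χ x) :
    DiffV (fun y => ψ y - χ y) x := MDifferentiableAt.sub hψ hχ

theorem nablaV_add {ψ χ : M → Spinor} (hψ : DiffV ψ x) (hχ : DiffV χ x)
    (X : TangentSpace 𝓘(ℝ, ℂ) x) :
    nablaV f (fun y => ψ y + χ y) x X = nablaV f ψ x X + nablaV f χ x X := by
  simp only [nablaV]
  rw [mvfderiv_fun_add hψ hχ, add_apply, map_add]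
  module

theorem nablaV_sub {ψ χ : M → Spinor} (hψ : DiffV ψ x) (hχ : DiffV χ x)
    (X : TangentSpace 𝓘(ℝ, ℂ) x) :
    nablaV f (fun y => ψ y - χ y) x X = nablaV f ψ x X - nablaV f χ x X := by
  simp only [nablaV]
  rw [mvfderiv_fun_sub hψ hχ, sub_apply, map_sub]
  module

theorem nablaV_smul {h : M → ℂ} {ψ : M → Spinor} (hh : MDifferentiableAt 𝓘(ℝ, ℂ) 𝓘(ℝ, ℂ) h x)
    (hψ : DiffV ψ x) (X : TangentSpace 𝓘(ℝ, ℂ) x) :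
    nablaV f (fun y => h y • ψ y) x X = dC h x X • ψ x + h x • nablaV f ψ x X := by
  have h1 : mvfderiv 𝓘(ℝ, ℂ) (fun y => h y • ψ y) x X
      = mvfderiv 𝓘(ℝ, ℂ) h x X • ψ x + h x • mvfderiv 𝓘(ℝ, ℂ) ψ x X :=
    mvfderiv_bilin ((ContinuousLinearMap.lsmul ℝ ℂ (E := Spinor))) hh hψ X
  simp only [nablaV, dC]
  rw [h1, map_smul]
  module

theorem nablaV_const_smul (c : ℂ) {ψ : M → Spinor} (hψ : DiffV ψ x)
    (X : TangentSpace 𝓘(ℝ, ℂ) x) :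
    nablaV f (fun y => c • ψ y) x X = c • nablaV f ψ x X := by
  rw [nablaV_smul (h := fun _ => c) mdifferentiableAt_const hψ, dC, mvfderiv_const]
  simp

/-- Clifford multiplication is parallel, because `φW = [φ,W] + Wφ`. -/
theorem nablaV_cliff {W : M → ℍ[ℝ]} {ψ : M → Spinor} (hW : DiffQ W x) (hψ : DiffV ψ x)
    (X : TangentSpace 𝓘(ℝ, ℂ) x) :
    nablaV f (fun y => cliff (W y) (ψ y)) x X
      = cliff (nablaT f W x X) (ψ x) + cliff (W x) (nablaV f ψ x X) := by
  have h1 : mvfderiv 𝓘(ℝ, ℂ) (fun y => cliff (W y) (ψ y)) x X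
      = cliff (mvfderiv 𝓘(ℝ, ℂ) W x X) (ψ x) + cliff (W x) (mvfderiv 𝓘(ℝ, ℂ) ψ x X) :=
    mvfderiv_bilin cliffEvalL hW hψ X
  simp only [nablaV, nablaT]
  rw [h1]
  simp only [cliff_add, cliff_sub, cliff_smul, add_apply, smul_apply, sub_apply, map_add, map_smul,
    cliff_mul]
  push_cast
  module

theorem dC_detForm (hf : IsConformalImmersion f) {ψ χ : M → Spinor} (hψ : DiffV ψ x)
    (hχ : DiffV χ x) (X : TangentSpace 𝓘(ℝ, ℂ) x) :
    dC (fun y => detForm (ψ y) (χ y)) x X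
      = detForm (nablaV f ψ x X) (χ x) + detForm (ψ x) (nablaV f χ x X) := by
  have h1 : dC (fun y => detForm (ψ y) (χ y)) x X
      = detForm (mvfderiv 𝓘(ℝ, ℂ) ψ x X) (χ x) + detForm (ψ x) (mvfderiv 𝓘(ℝ, ℂ) χ x X) :=
    mvfderiv_bilin detFormL hψ hχ X
  have h2 := detForm_cliff_add (phi f x X) (ψ x) (χ x)
  rw [phi_re hf] at h2
  simp only [nablaV, detForm_add_left, detForm_add_right, detForm_smul_left, detForm_smul_right]
  rw [h1]
  simp at h2
  linear_combination -2⁻¹ * h2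

/-- The connection induced by `nablaV` on `S`. -/
def connS (f : M → S3) : ConnOp M :=
  fun ψ x => ((projS f x).restrictScalars ℝ).comp (nablaVL f ψ x)

/-- The connection induced by `nablaV` on `S⁻¹`. -/
def connSinv (f : M → S3) : ConnOp M :=
  fun ψ x => ((projSinv f x).restrictScalars ℝ).comp (nablaVL f ψ x)

theorem connS_apply (ψ : M → Spinor) (X : TangentSpace 𝓘(ℝ, ℂ) x) :
    connS f ψ x X = projS f x (nablaV f ψ x X) := by
  rw [← nablaVL_apply]; rfl

theorem connSinv_apply (ψ : M → Spinor) (X : TangentSpace 𝓘(ℝ, ℂ) x) :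
    connSinv f ψ x X = projSinv f x (nablaV f ψ x X) := by
  rw [← nablaVL_apply]; rfl

theorem isConnectionOn_connS (hf : IsConformalImmersion f) :
    IsConnectionOn (spinS f) (connS f) where
  mem x ψ _ _ X := by
    rw [connS_apply]
    exact projS_mem hf _
  add x ψ χ _ _ hψ hχ X := by
    rw [connS_apply, connS_apply, connS_apply, nablaV_add hψ hχ, map_add]
  leibniz x h ψ hψs hh hψ X := by
    rw [connS_apply, connS_apply, nablaV_smul hh hψ, map_add, map_smul, map_smul,
      projS_of_mem hf (hψs x)]

theorem isConnectionOn_connSinv (hf : IsConformalImmersion f) :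
    IsConnectionOn (spinSinv f) (connSinv f) where
  mem x ψ _ _ X := by
    rw [connSinv_apply]
    exact projSinv_mem hf _
  add x ψ χ _ _ hψ hχ X := by
    rw [connSinv_apply, connSinv_apply, connSinv_apply, nablaV_add hψ hχ, map_add]
  leibniz x h ψ hψs hh hψ X := by
    rw [connSinv_apply, connSinv_apply, nablaV_smul hh hψ, map_add, map_smul, map_smul,
      projSinv_of_mem hf (hψs x)]

theorem detForm_left_proj (hf : IsConformalImmersion f) {s : Spinor} (hs : s ∈ spinS f x)
    (v : Spinor) : detForm v s = detForm (projSinv f x v) s := by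
  conv_lhs => rw [← projSinv_add_projS (f := f) (x := x) v]
  rw [detForm_add_left, detForm_spinS hf (projS_mem hf v) hs, add_zero]

theorem detForm_right_proj (hf : IsConformalImmersion f) {t : Spinor} (ht : t ∈ spinSinv f x)
    (v : Spinor) : detForm t v = detForm t (projS f x v) := by
  conv_lhs => rw [← projSinv_add_projS (f := f) (x := x) v]
  rw [detForm_add_right, detForm_spinSinv hf ht (projSinv_mem hf v), zero_add]

theorem isDualConnection_conn (hf : IsConformalImmersion f) :
    IsDualConnection f (connS f) (connSinv f) where
  isConnection := isConnectionOn_connSinv hf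
  dual x t s ht hs htd hsd X := by
    rw [dC_detForm hf htd hsd, detForm_left_proj hf (hs x), detForm_right_proj hf (ht x),
      connSinv_apply, connS_apply]

theorem adjoint_projSinv (hf : IsConformalImmersion f) (x : M) :
    ContinuousLinearMap.adjoint (projSinv f x) = projSinv f x := by
  rw [← starProjection_spinSinv hf]
  exact (isSelfAdjoint_starProjection _).adjoint_eq

theorem exists_higgs_eq (hf : IsConformalImmersion f) {t : Spinor} (ht : t ∈ spinSinv f x) :
    ∃ (Y : TangentSpace 𝓘(ℝ, ℂ) x) (s : Spinor), s ∈ spinS f x ∧ higgs f x Y s = t := by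
  have hc := (conformalFactor_pos hf x).ne'
  -- Since `φ(1)² = -λ` with `λ` the conformal factor, `-2/λ` compensates both this square and the
  -- `½` in `Φ(Y)s = ½φ(Y)s`.
  refine ⟨coordRe x, ((-2 / conformalFactor f x : ℝ) : ℂ) • cliff (phi f x (coordRe x)) t,
    Submodule.smul_mem _ _ (cliff_mem_spinS hf (phi_mul_unitNormal hf _) ht), ?_⟩
  rw [higgs_of_mem_spinS hf (Submodule.smul_mem _ _
    (cliff_mem_spinS hf (phi_mul_unitNormal hf _) ht)), map_smul, ← cliff_mul,
    phi_coordRe_mul_self hf, cliff_coe, smul_apply, one_apply_eq_self, smul_smul, smul_smul,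
    ← Complex.ofReal_ofNat, ← Complex.ofReal_inv, ← Complex.ofReal_mul, ← Complex.ofReal_mul]
  have h : (2⁻¹ * (-2 / conformalFactor f x * -conformalFactor f x) : ℝ) = 1 := by field_simp
  rw [← mul_assoc] at h
  rw [h, Complex.ofReal_one, one_smul]

variable [IsManifold 𝓘(ℂ) ω M]

theorem DiffVF.higgs (hf : IsConformalImmersion f) {Y : ∀ y : M, TangentSpace 𝓘(ℝ, ℂ) y}
    (hY : DiffVF Y x) {ψ : M → Spinor} (hψ : DiffV ψ x) :
    DiffV (fun y => higgs f y (Y y) (ψ y)) x := by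
  simp only [higgs_apply hf]
  have h := (hY.phi hf).cliff_apply hψ
  exact (h.sub (((diffQ_unitNormal hf x).cliff_apply h).const_smul _)).const_smul _

theorem nablaV_higgs (hf : IsConformalImmersion f) {Y : ∀ y : M, TangentSpace 𝓘(ℝ, ℂ) y}
    (hY : DiffVF Y x) {ψ : M → Spinor} (hψ : DiffV ψ x) (X : TangentSpace 𝓘(ℝ, ℂ) x) :
    nablaV f (fun y => higgs f y (Y y) (ψ y)) x X
      = (4⁻¹ : ℂ) • (cliff (nablaT f (fun y => phi f y (Y y)) x X) (ψ x) - Complex.I •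
          (cliff (nablaNormal f x X * phi f x (Y x)) (ψ x) + cliff (unitNormal f x)
            (cliff (nablaT f (fun y => phi f y (Y y)) x X) (ψ x))))
        + higgs f x (Y x) (nablaV f ψ x X) := by
  have h := (hY.phi hf).cliff_apply hψ
  have hR := (diffQ_unitNormal hf x).cliff_apply h
  simp only [higgs_apply hf]
  rw [nablaV_const_smul _ (h.sub (hR.const_smul _)), nablaV_sub h (hR.const_smul _),
    nablaV_const_smul _ hR, nablaV_cliff (diffQ_unitNormal hf x) h, nablaV_cliff (hY.phi hf) hψ,
    map_add, cliff_mul]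
  module

theorem isHolomorphicHiggs (hf : IsConformalImmersion f) (hmin : IsMinimal f) :
    IsHolomorphicHiggs f where
  map_add x X Y := by
    ext1 v
    simp only [higgs_apply' hf, add_apply, phi_add, cliff_add, smul_add]
  map_J x X := by
    ext1 v
    rw [smul_apply, higgs_apply hf, higgs_apply hf, ← unitNormal_mul_phi hf, cliff_mul,
      cliff_unitNormal_sq hf, smul_comm, smul_sub Complex.I, smul_smul Complex.I, Complex.I_mul_I]
    module
  map_smul x r X := by
    ext1 v
    rw [smul_apply, higgs_apply' hf, higgs_apply' hf, phi_smul, cliff_smul, smul_apply, smul_comm]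
  trace_zero x X := by
    have h : (higgs f x X : Spinor →ₗ[ℂ] Spinor) = (4⁻¹ : ℂ) • ((cliff (phi f x X)).toLinearMap
      - Complex.I • (cliff (phi f x (rotJ X))).toLinearMap) := rfl
    rw [h, map_smul, map_sub, map_smul, trace_cliff, trace_cliff, phi_re hf, phi_re hf]
    simp
  diff x Y ψ hY hψ := hY.higgs hf hψ
  dbar_zero x X Y ψ hX hY hψ := by
    -- The `∇R` terms agree by minimality and cancel; the remaining ones assemble to `¼(1 - iR)`
    -- applied to the torsion identity, which is `Φ` of the bracket.
    rw [nablaV_higgs hf hX hψ, nablaV_higgs hf hY hψ, add_sub_cancel_right, add_sub_cancel_right,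
      nablaNormal_mul_phi_symm hf hmin (X x), higgs_apply hf, ← nablaT_phi_sub hf hX hY, cliff_sub,
      sub_apply, map_sub]
    module

/-- The off-diagonal part of the connection on `S⁻¹`. -/
theorem projS_nablaV (hf : IsConformalImmersion f) {t : M → Spinor}
    (ht : IsSection (spinSinv f) t) (htd : DiffV t x) (X : TangentSpace 𝓘(ℝ, ℂ) x) :
    projS f x (nablaV f t x X) = (-(Complex.I / 2)) • cliff (nablaNormal f x X) (t x) := by
  -- Differentiating `Rt = it` gives `R∇t = i∇t - (∇R)t`, which is inserted into `½(1 + iR)∇t`.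
  have h := nablaV_cliff (f := f) (diffQ_unitNormal hf x) htd X
  simp only [(mem_spinSinv hf).1 (ht _)] at h
  rw [nablaV_const_smul _ htd] at h
  have h2 := eq_sub_of_add_eq' h.symm
  rw [projS_apply, h2, smul_sub, smul_smul Complex.I Complex.I, Complex.I_mul_I]
  module

/-- The off-diagonal part of the connection on `S`. -/
theorem projSinv_nablaV (hf : IsConformalImmersion f) {s : M → Spinor}
    (hs : IsSection (spinS f) s) (hsd : DiffV s x) (X : TangentSpace 𝓘(ℝ, ℂ) x) :
    projSinv f x (nablaV f s x X) = (Complex.I / 2) • cliff (nablaNormal f x X) (s x) := by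
  have h := nablaV_cliff (f := f) (diffQ_unitNormal hf x) hsd X
  simp only [(mem_spinS hf).1 (hs _), ← neg_smul] at h
  rw [nablaV_const_smul _ hsd] at h
  have h2 := eq_sub_of_add_eq' h.symm
  rw [projSinv_apply, h2, smul_sub Complex.I, smul_smul Complex.I, mul_neg, Complex.I_mul_I]
  module

/-- The Higgs field is parallel. -/
theorem connSinv_higgs (hf : IsConformalImmersion f) {Y : ∀ y : M, TangentSpace 𝓘(ℝ, ℂ) y}
    (hY : DiffVF Y x) {s : M → Spinor} (hs : IsSection (spinS f) s) (hsd : DiffV s x)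
    (X : TangentSpace 𝓘(ℝ, ℂ) x) :
    connSinv f (fun y => higgs f y (Y y) (s y)) x X
      = higgs f x (leviCivita hf Y x X) (s x) + higgs f x (Y x) (connS f s x X) := by
  have h1 : (fun y => higgs f y (Y y) (s y))
      = fun y => (2⁻¹ : ℂ) • cliff (phi f y (Y y)) (s y) :=
    funext fun y => higgs_of_mem_spinS hf (hs y) (Y y)
  rw [connSinv_apply, h1, nablaV_const_smul _ ((hY.phi hf).cliff_apply hsd),
    nablaV_cliff (hY.phi hf) hsd, phi_leviCivita hf hY, cliff_add, cliff_smul, add_apply,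
    smul_apply, (mem_spinS hf).1 (hs x), higgs_of_mem_spinS hf (hs x), connS_apply,
    higgs_of_mem_spinS hf (projS_mem hf _)]
  -- Two terms lie in `S` and are killed by the projection: the normal part of `∇φ(Y)`, which acts
  -- on `s` as a scalar, and `φ(Y)` applied to the `S⁻¹`-part of `∇s`.
  conv_lhs => rw [← projSinv_add_projS (f := f) (x := x) (nablaV f s x X)]
  simp only [map_add, map_smul, map_neg]
  rw [projSinv_of_mem hf (cliff_mem_spinSinv hf (phi_mul_unitNormal hf _) (hs x)),
    projSinv_of_mem_spinS hf (hs x),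
    projSinv_of_mem_spinS hf (cliff_mem_spinS hf (phi_mul_unitNormal hf _) (projSinv_mem hf _)),
    projSinv_of_mem hf (cliff_mem_spinSinv hf (phi_mul_unitNormal hf _) (projS_mem hf _))]
  module

theorem isSpinConnection_connS (hf : IsConformalImmersion f) :
    IsSpinConnection f (leviCivita hf) (connS f) where
  isConnection := isConnectionOn_connS hf
  parallel x s₁ s₂ Y hs₁ hs₂ hd₁ hd₂ hY X := by
    simp only [sqForm]
    rw [dC_detForm hf (hY.higgs hf hd₁) hd₂, detForm_left_proj hf (hs₂ x),
      detForm_right_proj hf (higgs_mem_spinSinv hf (hs₁ x) _), ← connSinv_apply, ← connS_apply,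
      connSinv_higgs hf hY hs₁ hd₁, detForm_add_left]
    ring

theorem diffV_projS (hf : IsConformalImmersion f) (v : Spinor) (x : M) :
    DiffV (fun y => projS f y v) x := by
  simp only [projS_apply]
  have h : DiffV (fun _ : M => v) x := mdifferentiableAt_const
  exact (h.add (((diffQ_unitNormal hf x).cliff_apply h).const_smul _)).const_smul _

theorem exists_section_spinS (hf : IsConformalImmersion f) (x : M) :
    ∃ s : M → Spinor, IsSection (spinS f) s ∧ DiffV s x ∧ s x ≠ 0 := by
  obtain ⟨v, hv, hv0⟩ := exists_mem_spinS hf x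
  refine ⟨fun y => projS f y v, fun y => projS_mem hf v, diffV_projS hf v x, ?_⟩
  simpa only [projS_of_mem hf hv] using hv0

/-- Uniqueness of the spin connection. -/
theorem IsSpinConnection.eq_connS (hf : IsConformalImmersion f)
    {D : CovariantDerivative 𝓘(ℝ, ℂ) ℂ (fun x : M => TangentSpace 𝓘(ℝ, ℂ) x)}
    {ns : ConnOp M} (hD : IsLeviCivita f D) (hns : IsSpinConnection f D ns) {s : M → Spinor}
    (hs : IsSection (spinS f) s) (hsd : DiffV s x) (X : TangentSpace 𝓘(ℝ, ℂ) x) :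
    ns s x X = connS f s x X := by
  obtain ⟨Y, hY, hYx⟩ := exists_diffVF (coordRe x)
  have hY0 : Y x ≠ 0 := hYx ▸ coordRe_ne_zero x
  obtain ⟨σ, hσ, hσd, hσ0⟩ := exists_section_spinS hf x
  have hmem : ∀ {s : M → Spinor}, IsSection (spinS f) s → DiffV s x →
      ns s x X - connS f s x X ∈ spinS f x := fun hs hsd =>
    Submodule.sub_mem _ (hns.isConnection.mem x _ hs hsd X)
      ((isConnectionOn_connS hf).mem x _ hs hsd X)
  have hleft : ∀ u v w : Spinor,
      sqForm f x (u - v) w (Y x) = sqForm f x u w (Y x) - sqForm f x v w (Y x) :=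
    fun u v w => by simp only [sqForm, map_sub, detForm, PiLp.sub_apply]; ring
  have hright : ∀ u v w : Spinor,
      sqForm f x w (u - v) (Y x) = sqForm f x w u (Y x) - sqForm f x w v (Y x) :=
    fun u v w => by simp only [sqForm, detForm, PiLp.sub_apply]; ring
  -- The difference of two spin connections is skew for the form `S ⊗ S → K`.
  have key : ∀ {s₁ s₂ : M → Spinor}, IsSection (spinS f) s₁ → IsSection (spinS f) s₂ →
      DiffV s₁ x → DiffV s₂ x → sqForm f x (ns s₁ x X - connS f s₁ x X) (s₂ x) (Y x)
        + sqForm f x (s₁ x) (ns s₂ x X - connS f s₂ x X) (Y x) = 0 := by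
    intro s₁ s₂ h₁ h₂ hd₁ hd₂
    have e1 := hns.parallel x s₁ s₂ Y h₁ h₂ hd₁ hd₂ hY X
    have e2 := (isSpinConnection_connS hf).parallel x s₁ s₂ Y h₁ h₂ hd₁ hd₂ hY X
    rw [hD.eq_leviCivita hf hY] at e1
    rw [hleft, hright]
    linear_combination e2 - e1
  -- That form is symmetric, so taking `σ` twice makes the difference vanish on `σ`; pairing with
  -- `σ` then handles an arbitrary section.
  have h1 := key hσ hσ hσd hσd
  rw [sqForm_symm hf (hσ x) (hmem hσ hσd), ← two_mul] at h1
  have h2 := sqForm_ne_zero hf (hmem hσ hσd) (hσ x) hY0 hσ0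
    ((mul_eq_zero.1 h1).resolve_left two_ne_zero)
  have h3 := key hs hσ hsd hσd
  have h4 : sqForm f x (s x) 0 (Y x) = 0 := by simp [sqForm, detForm]
  rw [h2, h4, add_zero] at h3
  exact sub_eq_zero.1 (sqForm_ne_zero hf (hmem hs hsd) (hσ x) hY0 hσ0 h3)

/-- Uniqueness of the dual of the spin connection. -/
theorem IsDualConnection.eq_connSinv (hf : IsConformalImmersion f)
    {D : CovariantDerivative 𝓘(ℝ, ℂ) ℂ (fun x : M => TangentSpace 𝓘(ℝ, ℂ) x)}
    {ns nt : ConnOp M} (hD : IsLeviCivita f D) (hns : IsSpinConnection f D ns)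
    (hnt : IsDualConnection f ns nt) {t : M → Spinor} (ht : IsSection (spinSinv f) t)
    (htd : DiffV t x) (X : TangentSpace 𝓘(ℝ, ℂ) x) :
    nt t x X = connSinv f t x X := by
  obtain ⟨σ, hσ, hσd, hσ0⟩ := exists_section_spinS hf x
  have e1 := hnt.dual x t σ ht hσ htd hσd X
  have e2 := (isDualConnection_conn hf).dual x t σ ht hσ htd hσd X
  rw [hns.eq_connS hf hD hσ hσd] at e1
  have h : detForm (nt t x X - connSinv f t x X) (σ x) = 0 := by
    have h1 : detForm (nt t x X - connSinv f t x X) (σ x)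
        = detForm (nt t x X) (σ x) - detForm (connSinv f t x X) (σ x) := by
      simp only [detForm, PiLp.sub_apply]; ring
    rw [h1]
    linear_combination e2 - e1
  exact sub_eq_zero.1 (detForm_ne_zero hf (Submodule.sub_mem _
    (hnt.isConnection.mem x _ ht htd X) ((isConnectionOn_connSinv hf).mem x _ ht htd X))
    (hσ x) hσ0 h)

/-! ### The Hopf field as an operator -/

/-- The Hopf field as a section of `K Hom(S⁻¹, S)`. -/
def hopfOperator (f : M → S3) (x : M) (X : TangentSpace 𝓘(ℝ, ℂ) x) : Spinor →L[ℂ] Spinor :=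
  (cliff (nablaNormal f x X)).comp (projSinv f x)

/-- On `S⁻¹` the Hopf field is Clifford multiplication by `∇R`: on `S`, `½ ∇_X R · φ(Y)` equals
`½(II(X,Y) - i II(X,JY))`, which is `Q(X,Y)` by minimality. -/
theorem isHopfOperator_hopfOperator (hf : IsConformalImmersion f) (hmin : IsMinimal f) :
    IsHopfOperator f (hopfOperator f) where
  map_S x X s hs := by
    rw [hopfOperator, ContinuousLinearMap.comp_apply, projSinv_of_mem_spinS hf hs, map_zero]
  map_Sinv x X t ht := by
    rw [hopfOperator, ContinuousLinearMap.comp_apply, projSinv_of_mem hf ht]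
    exact cliff_mem_spinS hf (nablaNormal_mul_unitNormal hf X) ht
  ident x X Y s hs := by
    rw [hopfOperator, ContinuousLinearMap.comp_apply,
      projSinv_of_mem hf (higgs_mem_spinSinv hf hs Y), higgs_of_mem_spinS hf hs, map_smul,
      ← cliff_mul, nablaNormal_mul_phi hf, cliff_add, cliff_coe, cliff_smul, hopf_eq hf hmin]
    simp only [add_apply, smul_apply, (mem_spinS hf).1 hs, one_apply_eq_self]
    module

/-- The vectors `Φ(Y)s` exhaust `S⁻¹`, so the defining identity determines the operator. -/
theorem IsHopfOperator.eq_hopfOperator (hf : IsConformalImmersion f) (hmin : IsMinimal f)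
    {q : ∀ x : M, TangentSpace 𝓘(ℝ, ℂ) x → Spinor →L[ℂ] Spinor} (hq : IsHopfOperator f q)
    (X : TangentSpace 𝓘(ℝ, ℂ) x) : q x X = hopfOperator f x X := by
  ext1 v
  rw [← projSinv_add_projS (f := f) (x := x) v, map_add, map_add, hq.map_S x X _ (projS_mem hf v),
    (isHopfOperator_hopfOperator hf hmin).map_S x X _ (projS_mem hf v)]
  obtain ⟨Y, s, hs, h⟩ := exists_higgs_eq hf (projSinv_mem hf v)
  rw [← h, hq.ident x X Y s hs, (isHopfOperator_hopfOperator hf hmin).ident x X Y s hs]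

/-- `∇R` is imaginary, hence skew-Hermitian; this sign gives both off-diagonal entries of the matrix
the same factor `-i/2`. -/
theorem adjoint_hopfOperator (hf : IsConformalImmersion f) (X : TangentSpace 𝓘(ℝ, ℂ) x)
    {s : Spinor} (hs : s ∈ spinS f x) :
    ContinuousLinearMap.adjoint (hopfOperator f x X) s = -cliff (nablaNormal f x X) s := by
  rw [hopfOperator, ContinuousLinearMap.adjoint_comp, adjoint_projSinv hf,
    adjoint_cliff (nablaNormal_re hf X), ContinuousLinearMap.comp_apply, neg_apply, map_neg,
    projSinv_of_mem hf (cliff_mem_spinSinv hf (nablaNormal_mul_unitNormal hf X) hs)]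

/-- The projection is an affine function of the smooth map `R`. -/
theorem contMDiff_starProjection (hf : IsConformalImmersion f) :
    ContMDiff 𝓘(ℝ, ℂ) 𝓘(ℝ, Spinor →L[ℂ] Spinor) ∞ (fun x => (spinSinv f x).starProjection) := by
  simp only [starProjection_spinSinv hf]
  have h : ContDiff ℝ ∞ fun p : ℍ[ℝ] =>
      (2⁻¹ : ℂ) • ((1 : Spinor →L[ℂ] Spinor) - Complex.I • cliffL p) :=
    (contDiff_const.sub (cliffL.contDiff.const_smul Complex.I)).const_smul (2⁻¹ : ℂ)
  exact h.contMDiff.comp (contMDiff_unitNormal hf)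

/-- The matrix of the connection with respect to the splitting. -/
theorem nablaV_eq (hf : IsConformalImmersion f) {t s : M → Spinor}
    (ht : IsSection (spinSinv f) t) (hs : IsSection (spinS f) s) (htd : DiffV t x)
    (hsd : DiffV s x) (X : TangentSpace 𝓘(ℝ, ℂ) x) :
    nablaV f (fun y => t y + s y) x X
      = (connSinv f t x X
          + (-(Complex.I / 2)) • ContinuousLinearMap.adjoint (hopfOperator f x X) (s x))
        + ((-(Complex.I / 2)) • hopfOperator f x X (t x) + connS f s x X) := by
  have h : hopfOperator f x X (t x) = cliff (nablaNormal f x X) (t x) := by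
    rw [hopfOperator, ContinuousLinearMap.comp_apply, projSinv_of_mem hf (ht x)]
  rw [nablaV_add htd hsd, adjoint_hopfOperator hf X (hs x), h, ← projS_nablaV hf ht htd,
    smul_neg, neg_smul, neg_neg, ← projSinv_nablaV hf hs hsd, connS_apply, connSinv_apply]
  conv_lhs => rw [← projSinv_add_projS (f := f) (x := x) (nablaV f t x X),
    ← projSinv_add_projS (f := f) (x := x) (nablaV f s x X)]
  abel

end SpinConnection

end MinimalSurface

end

/-! ### The theorem, reduced by uniqueness to the projected connections. -/

theorem mainTheorem5 {M : Type*} [TopologicalSpace M] [ChartedSpace ℂ M] [IsManifold 𝓘(ℂ) ω M]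
    (f : M → S3) (hf : IsConformalImmersion f) (hmin : IsMinimal f) :
    -- `V = S⁻¹ ⊕ S` is a smooth orthogonal splitting into complex line bundles
    (∀ x, Module.finrank ℂ (spinSinv f x) = 1 ∧ Module.finrank ℂ (spinS f x) = 1) ∧
    ContMDiff 𝓘(ℝ, ℂ) 𝓘(ℝ, Spinor →L[ℂ] Spinor) ∞ (fun x => (spinSinv f x).starProjection) ∧
    -- the connections and the endomorphism-valued form in the statement exist
    (∃ D ns nt, IsLeviCivita f D ∧ IsSpinConnection f D ns ∧ IsDualConnection f ns nt) ∧
    (∃ q, IsHopfOperator f q) ∧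
    -- the matrix of the connection
    (∀ D ns nt q, IsLeviCivita f D → IsSpinConnection f D ns → IsDualConnection f ns nt →
      IsHopfOperator f q →
      ∀ x t s, IsSection (spinSinv f) t → IsSection (spinS f) s → DiffV t x → DiffV s x →
      ∀ X : TangentSpace 𝓘(ℝ, ℂ) x,
        nablaV f (fun y => t y + s y) x X
          = (nt t x X + (-(Complex.I / 2)) • ContinuousLinearMap.adjoint (q x X) (s x))
            + ((-(Complex.I / 2)) • q x X (t x) + ns s x X)) ∧
    -- the Higgs field is holomorphic, and it is a nowhere vanishing section of
    -- `K Hom(S, S⁻¹)`: half the Clifford multiplication on `S`, zero on `S⁻¹`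
    IsHolomorphicHiggs f ∧
    (∀ x (Y : TangentSpace 𝓘(ℝ, ℂ) x),
      (∀ t ∈ spinSinv f x, higgs f x Y t = 0) ∧
      (∀ s ∈ spinS f x, higgs f x Y s ∈ spinSinv f x ∧
        higgs f x Y s = (2⁻¹ : ℂ) • cliff (phi f x Y) s) ∧
      (Y ≠ 0 → ∀ s₁ ∈ spinS f x, ∀ s₂ ∈ spinS f x, s₁ ≠ 0 → s₂ ≠ 0 → sqForm f x s₁ s₂ Y ≠ 0)) ∧
    -- it is the section `1`: it is parallel for the induced connection on `K Hom(S, S⁻¹)`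
    (∀ D ns nt, IsLeviCivita f D → IsSpinConnection f D ns → IsDualConnection f ns nt →
      ∀ x s (Y : ∀ y : M, TangentSpace 𝓘(ℝ, ℂ) y), IsSection (spinS f) s → DiffV s x → DiffVF Y x →
      ∀ X : TangentSpace 𝓘(ℝ, ℂ) x,
        nt (fun y => higgs f y (Y y) (s y)) x X
          = higgs f x (D Y x X) (s x) + higgs f x (Y x) (ns s x X)) ∧
    -- the adjoint, a section of `K̄ Hom(S⁻¹, S) = K̄ K`, is given by the volume form
    (∀ x (X Y : TangentSpace 𝓘(ℝ, ℂ) x),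
      (∀ s ∈ spinS f x, higgsAdj f x X s = 0) ∧
      (∀ t ∈ spinSinv f x, higgsAdj f x X t ∈ spinS f x) ∧
      ∀ s ∈ spinS f x,
        higgsAdj f x X (higgs f x Y s)
            = ((4⁻¹ : ℂ) * (inducedMetric f x X Y + Complex.I * volForm f x X Y)) • s ∧
        higgsAdj f x X (higgs f x Y s) - higgsAdj f x Y (higgs f x X s)
            = (Complex.I / 2 * volForm f x X Y) • s) := by
  refine ⟨finrank_spin hf, contMDiff_starProjection hf,
    ⟨leviCivita hf, connS f, connSinv f, isLeviCivita_leviCivita hf, isSpinConnection_connS hf,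
      isDualConnection_conn hf⟩,
    ⟨hopfOperator f, isHopfOperator_hopfOperator hf hmin⟩, ?_, isHolomorphicHiggs hf hmin, ?_, ?_,
    ?_⟩
  · intro D ns nt q hD hns hnt hq x t s ht hs htd hsd X
    rw [hnt.eq_connSinv hf hD hns ht htd, hns.eq_connS hf hD hs hsd, hq.eq_hopfOperator hf hmin]
    exact nablaV_eq hf ht hs htd hsd X
  · intro x Y
    exact ⟨fun t ht => higgs_of_mem_spinSinv ht Y,
      fun s hs => ⟨higgs_mem_spinSinv hf hs Y, higgs_of_mem_spinS hf hs Y⟩,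
      fun hY s₁ h₁ s₂ h₂ h₁0 h₂0 h => h₁0 (sqForm_ne_zero hf h₁ h₂ hY h₂0 h)⟩
  · intro D ns nt hD hns hnt x s Y hs hsd hY X
    rw [hnt.eq_connSinv hf hD hns (fun y => higgs_mem_spinSinv hf (hs y) (Y y))
      (hY.higgs hf hsd), hns.eq_connS hf hD hs hsd, hD.eq_leviCivita hf hY]
    exact connSinv_higgs hf hY hs hsd X
  · intro x X Y
    exact ⟨fun s hs => higgsAdj_of_mem_spinS hf hs X, fun t ht => higgsAdj_mem_spinS hf ht X,
      fun s hs => ⟨higgsAdj_higgs hf hs X Y, higgsAdj_higgs_sub hf hs X Y⟩⟩
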